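/- **Lemma 6.4.** Let $m\ge n$, let $\bar A$ be a real $m\times n$ matrix, $\bar b\in\mathbb R^m$, $\bar c\in\mathbb R^n$ with $\|\bar A\|,\|\bar b\|,\|\bar c\|\le 1$ (Euclidean norms and the induced operator norm), and let $0<\sigma$ with $\sigma^2\le 1$. Let $A,b,c$ be a Gaussian random matrix and two Gaussian random vectors of variance $\sigma^2$ centered at $\bar A,\bar b,\bar c$, i.e. all entries of $A,b,c$ are independent normal variables of variance $\sigma^2$ whose means are the corresponding entries of $\bar A,\bar b,\bar c$. Consider the linear program $\max cx$ subject to $Ax\le b$, $x\ge 0$, and its dual $\min yb$ subject to $yA\ge c$, $y\ge 0$. When the program is feasible and bounded, let $x^*$ and $y^*$ be primal and dual optimal solutions (unique with probability $1$; if there are several, fix any choice) and put $U=\{i: x^*_i>0\}$, $V=\{j: y^*_j>0\}$. For a primal feasible $x$ let $U(x)$ and $V(x)$ be sets of indices such that $\{x_i: i\notin U(x)\}\cup\{b_j-A_{j,:}x : j\in V(x)\}$ are the smallest $n$ values in the family $\{x_i\}_{i\le n}\cup\{b_j-A_{j,:}x\}_{j\le m}$. Let $\delta(A,b,c)\in[0,\infty]$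 be the supremum of the $d\ge 0$ such that every primal feasible $x$ with $cx^*-cx<d$ satisfies $U(x)=U$ and $V(x)=V$ (for every way of breaking ties in the choice of the smallest $n$ values). For infeasible or unbounded programs put $\delta(A,b,c)=\infty$. Then, for every $\epsilon\ge 0$, $$\Pr_{A,b,c}\Big[\delta(A,b,c)\,(\|A\|+3)^7\,(1+\|x^*\|+\|y^*\|)^4\le\epsilon\Big]\ \le\ \frac{21\,\epsilon^{1/3}\,n^{1/6}\,(n+1)(m+1)}{\sigma^2},$$ where the event is understood not to occur when the program is infeasible or unbounded. -/

import Mathlib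

open MeasureTheory ProbabilityTheory
open scoped ENNReal NNReal Matrix

namespace LinProg

noncomputable section

variable {m n : ℕ}

/-- The Euclidean norm of a vector given by its coordinates. -/
def vecNorm {k : ℕ} (x : Fin k → ℝ) : ℝ := ‖WithLp.toLp 2 x‖

/-- The norm of a matrix as an operator between Euclidean spaces. -/
def opNorm (A : Matrix (Fin m) (Fin n) ℝ) : ℝ :=
  ‖LinearMap.toContinuousLinearMap (Matrix.toEuclideanLin A)‖

/-- `x` is feasible for the primal program: max `c x` subject to `A x ≤ b`, `x ≥ 0`. -/
def PrimalFeasible (A : Matrix (Fin m) (Fin n) ℝ) (b : Fin m → ℝ) (x : Fin n → ℝ) : Prop :=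
  A *ᵥ x ≤ b ∧ 0 ≤ x

/-- `y` is feasible for the dual program: min `y b` subject to `y A ≥ c`, `y ≥ 0`. -/
def DualFeasible (A : Matrix (Fin m) (Fin n) ℝ) (c : Fin n → ℝ) (y : Fin m → ℝ) : Prop :=
  c ≤ y ᵥ* A ∧ 0 ≤ y

def IsPrimalOptimal (A : Matrix (Fin m) (Fin n) ℝ) (b : Fin m → ℝ) (c : Fin n → ℝ)
    (x : Fin n → ℝ) : Prop :=
  PrimalFeasible A b x ∧ ∀ z, PrimalFeasible A b z → c ⬝ᵥ z ≤ c ⬝ᵥ x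

def IsDualOptimal (A : Matrix (Fin m) (Fin n) ℝ) (b : Fin m → ℝ) (c : Fin n → ℝ)
    (y : Fin m → ℝ) : Prop :=
  DualFeasible A c y ∧ ∀ z, DualFeasible A c z → y ⬝ᵥ b ≤ z ⬝ᵥ b

/-- The (primal) program is feasible and its objective is bounded above on the feasible set. -/
def FeasibleBounded (A : Matrix (Fin m) (Fin n) ℝ) (b : Fin m → ℝ) (c : Fin n → ℝ) : Prop :=
  (∃ x, PrimalFeasible A b x) ∧ BddAbove ((fun x => c ⬝ᵥ x) '' {x | PrimalFeasible A b x})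

open Classical in
/-- The primal optimal solution `x*` (some optimal solution if there are several,
and `0` if there is none). -/
def xStar (A : Matrix (Fin m) (Fin n) ℝ) (b : Fin m → ℝ) (c : Fin n → ℝ) : Fin n → ℝ :=
  if h : ∃ x, IsPrimalOptimal A b c x then h.choose else 0

open Classical in
/-- The dual optimal solution `y*` (some optimal solution if there are several,
and `0` if there is none). -/
def yStar (A : Matrix (Fin m) (Fin n) ℝ) (b : Fin m → ℝ) (c : Fin n → ℝ) : Fin m → ℝ :=
  if h : ∃ y, IsDualOptimal A b c y then h.choose else 0

open Classical in
/-- `U = {i | x*_i > 0}`. -/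
def typeU (A : Matrix (Fin m) (Fin n) ℝ) (b : Fin m → ℝ) (c : Fin n → ℝ) : Finset (Fin n) :=
  Finset.univ.filter fun i => 0 < xStar A b c i

open Classical in
/-- `V = {j | y*_j > 0}`. -/
def typeV (A : Matrix (Fin m) (Fin n) ℝ) (b : Fin m → ℝ) (c : Fin n → ℝ) : Finset (Fin m) :=
  Finset.univ.filter fun j => 0 < yStar A b c j

/-- The slacks of the `n + m` inequalities at `x`: the numbers `x_i` and `b_j - A_{j,:} x`. -/
def slack (A : Matrix (Fin m) (Fin n) ℝ) (b : Fin m → ℝ) (x : Fin n → ℝ) : Fin n ⊕ Fin m → ℝ :=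
  Sum.elim x (fun j => b j - (A *ᵥ x) j)

/-- `(U, V)` is a possible outcome `(U(x), V(x))` of the guess of the termination procedure at `x`:
the family `{x_i : i ∉ U} ∪ {b_j - A_{j,:} x : j ∈ V}` consists of `n` smallest members of the family
of all slacks. (The outcome is unique unless there is a tie between the `n`-th and the
`(n+1)`-st smallest slack.) -/
def IsGuess (A : Matrix (Fin m) (Fin n) ℝ) (b : Fin m → ℝ) (x : Fin n → ℝ)
    (U : Finset (Fin n)) (V : Finset (Fin m)) : Prop :=
  (Uᶜ.disjSum V).card = n ∧
    ∀ s ∈ Uᶜ.disjSum V, ∀ t ∉ Uᶜ.disjSum V, slack A b x s ≤ slack A b x t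

open Classical in
/-- `δ(A, b, c)`: for a feasible and bounded program, the supremum of the `d` such that the guess
at every feasible `x` with `c x* - c x < d` is `(U, V)`, however ties are broken;
`∞` for other programs. -/
def delta (A : Matrix (Fin m) (Fin n) ℝ) (b : Fin m → ℝ) (c : Fin n → ℝ) : ℝ≥0∞ :=
  if FeasibleBounded A b c then
    ⨆ (d : ℝ≥0) (_ : ∀ x, PrimalFeasible A b x → c ⬝ᵥ xStar A b c - c ⬝ᵥ x < d →
      ∀ U V, IsGuess A b x U V → U = typeU A b c ∧ V = typeV A b c), (d : ℝ≥0∞)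
  else ⊤

/-- The law of a Gaussian vector of variance `v` centered at `a`: independent coordinates,
the `i`-th one normal with mean `a i` and variance `v`. -/
def gaussianVec {k : ℕ} (a : Fin k → ℝ) (v : ℝ≥0) : Measure (Fin k → ℝ) :=
  Measure.pi fun i => gaussianReal (a i) v

/-- The law of a Gaussian matrix of variance `v` centered at `M`, as an array of entries:
independent entries, the `(i, j)` one normal with mean `M i j` and variance `v`. -/
def gaussianMat (M : Matrix (Fin m) (Fin n) ℝ) (v : ℝ≥0) : Measure (Fin m → Fin n → ℝ) :=
  Measure.pi fun i => gaussianVec (M i) v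

/-- The joint law of independent Gaussian `(A, b, c)` of variance `v` centered at `(A₀, b₀, c₀)`. -/
def gaussianLP (A₀ : Matrix (Fin m) (Fin n) ℝ) (b₀ : Fin m → ℝ) (c₀ : Fin n → ℝ) (v : ℝ≥0) :
    Measure ((Fin m → Fin n → ℝ) × (Fin m → ℝ) × (Fin n → ℝ)) :=
  (gaussianMat A₀ v).prod ((gaussianVec b₀ v).prod (gaussianVec c₀ v))

end

end LinProg

/-! The guess at a near-optimal point `w` is right as soon as one threshold separates the slacks
that vanish at the optimum from those that do not. Put θ = η / `scale A` and let `w` be feasible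
with objective gap below θ²/2.

If the dual slack of a vanishing variable (or the dual variable of a tight constraint) is at least
θ, the duality gap, being a sum of nonnegative complementarity products, forces the corresponding
primal slack at `w` below θ/2. If a variable is positive, lower its objective coefficient by θ: if
some optimum `u` of the new program still has `u i ≥ θ`, comparing `u` with `w` there gives `w i >
θ/2`. Constraints with positive slack are treated alike, moving the objective by θ times the row.
This is `slack_threshold`. So δ ≥ θ²/2 unless a dual quantity is small, the perturbation destroys
positivity, or the perturbed slack is small; the union of these events is `fragile`.

Each event is rare because of a direction in the space of right-hand sides or objectives along which
it cannot occur at two points with parameters θ or more apart: moving along it raises the quantity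
in question linearly or restores its positivity. A Gaussian vector can be resampled along a fixed
direction, and the one-dimensional density is at most 1/(2σ), so each event has probability at most
η/(2σ) (`gaussianVec_le_of_gap`). With three events per index the union bound is 3(n+m)η/(2σ).
Strict complementarity and |U| = |V| hold off a null set by counting dimensions
(`strictlyComplementary`).

The normalization more than compensates the factor θ²/2 = η²/(2 `scale A`²), so η may tend to √ε.
The resulting bound of order √ε/σ is stronger than the stated ε^(1/3)/σ². -/

namespace LinProg

/-! ### Farkas' lemma and linear programming duality. -/

/-- Farkas' lemma for finitely many vectors of a real vector space. -/
theorem farkas_fin {E : Type*} [AddCommGroup E] [Module ℝ E] (k : ℕ) (v : Fin k → E) (b : E) :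
    (∃ l : Fin k → ℝ, 0 ≤ l ∧ ∑ i, l i • v i = b) ∨
      ∃ f : Module.Dual ℝ E, (∀ i, 0 ≤ f (v i)) ∧ f b < 0 := by
  induction k generalizing b with
  | zero =>
    by_cases hb : b = 0
    · exact Or.inl ⟨0, le_rfl, by simp [hb]⟩
    · right
      obtain ⟨f, hf⟩ : ∃ f : Module.Dual ℝ E, f b ≠ 0 := by
        by_contra! h
        exact hb ((Module.forall_dual_apply_eq_zero_iff ℝ b).1 h)
      rcases lt_or_gt_of_ne hf with h | h
      · exact ⟨f, fun i => i.elim0, h⟩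
      · exact ⟨-f, fun i => i.elim0, by simpa using h⟩
  | succ k ih =>
    rcases ih (fun i => v i.succ) b with ⟨l, hl, hb⟩ | ⟨f, hf, hfb⟩
    · left
      refine ⟨Fin.cons 0 l, fun i => ?_, by simp [Fin.sum_univ_succ, hb]⟩
      refine Fin.cases ?_ (fun j => ?_) i
      · simp
      · simpa using hl j
    by_cases h0 : 0 ≤ f (v 0)
    · exact Or.inr ⟨f, Fin.cases h0 hf, hfb⟩
    push Not at h0
    -- Here `f` separates `b` from all vectors but `v 0`, and `f (v 0) < 0`. Project onto the kernel
    -- of `f` along `v 0`; a cone representation of the projected `b` lifts, and a functional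
    -- separating it pulls back.
    let pr : E →ₗ[ℝ] E := LinearMap.id - (f.smulRight ((f (v 0))⁻¹ • v 0))
    have hpr : ∀ x, pr x = x - (f x / f (v 0)) • v 0 := fun x => by
      simp [pr, smul_smul, div_eq_mul_inv]
    have hpr0 : pr (v 0) = 0 := by rw [hpr, div_self h0.ne]; simp
    rcases ih (fun i => pr (v i.succ)) (pr b) with ⟨l, hl, hb⟩ | ⟨g, hg, hgb⟩
    · left
      -- The coefficient of `v 0` is forced by applying `f`; it is nonnegative since `f b` and `f (v
      -- 0)` are negative and the other values of `f` are not.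
      refine ⟨Fin.cons (f b / f (v 0) - ∑ i, l i * (f (v i.succ) / f (v 0))) l, fun i => ?_, ?_⟩
      · refine Fin.cases ?_ (fun j => ?_) i
        · simp only [Pi.zero_apply, Fin.cons_zero, sub_nonneg]
          refine le_trans (Finset.sum_nonpos fun j _ => ?_)
            (div_nonneg_of_nonpos hfb.le h0.le)
          exact mul_nonpos_of_nonneg_of_nonpos (hl j)
            (div_nonpos_of_nonneg_of_nonpos (hf j) h0.le)
        · simpa using hl j
      · simp only [hpr, smul_sub, Finset.sum_sub_distrib, smul_smul, ← Finset.sum_smul] at hb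
        rw [Fin.sum_univ_succ]
        simp only [Fin.cons_zero, Fin.cons_succ, sub_smul]
        rw [sub_eq_iff_eq_add] at hb
        rw [hb]
        abel
    · right
      refine ⟨g ∘ₗ pr, fun i => ?_, hgb⟩
      refine Fin.cases ?_ (fun j => ?_) i
      · simp [hpr0]
      · exact hg j

/-- Farkas' lemma for a system of linear inequalities in nonnegative variables. -/
theorem farkas_le {ι κ : Type*} [Fintype ι] [Fintype κ] (M : Matrix κ ι ℝ) (b : κ → ℝ) :
    (∃ x, 0 ≤ x ∧ M *ᵥ x ≤ b) ∨ ∃ g, 0 ≤ g ∧ 0 ≤ g ᵥ* M ∧ g ⬝ᵥ b < 0 := by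
  classical
  let e := Fintype.equivFin (ι ⊕ κ)
  -- The unit vectors serve as slack columns, turning the inequalities into an equation.
  let col : ι ⊕ κ → κ → ℝ := Sum.elim (fun i => M.col i) (fun j => Pi.single j 1)
  rcases farkas_fin _ (fun i => col (e.symm i)) b with ⟨l, hl, hb⟩ | ⟨f, hf, hfb⟩
  · left
    refine ⟨fun i => l (e (Sum.inl i)), fun i => hl _, ?_⟩
    rw [← Equiv.sum_comp e] at hb
    simp only [Equiv.symm_apply_apply, Fintype.sum_sum_type] at hb
    intro j
    have := congrFun hb j
    simp only [col, Pi.add_apply, Finset.sum_apply, Pi.smul_apply, Sum.elim_inl, Sum.elim_inr,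
      smul_eq_mul, Matrix.col_apply, Pi.single_apply, mul_ite, mul_one, mul_zero,
      Finset.sum_ite_eq, Finset.mem_univ, if_true] at this
    rw [← this]
    simp only [Matrix.mulVec, dotProduct]
    have h1 := hl (e (Sum.inr j))
    simp only [Pi.zero_apply] at h1
    rw [Finset.sum_congr rfl fun i _ => mul_comm (M j i) _]
    linarith
  · right
    have key : ∀ v : κ → ℝ, (fun j => f (Pi.single j 1)) ⬝ᵥ v = f v := fun v => by
      conv_rhs => rw [pi_eq_sum_univ' v]
      simp [dotProduct, mul_comm]
    refine ⟨fun j => f (Pi.single j 1), fun j => ?_, fun i => ?_, by rwa [key]⟩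
    · simpa [col] using hf (e (Sum.inr j))
    · have := hf (e (Sum.inl i))
      rw [← key] at this
      simp only [Equiv.symm_apply_apply] at this
      exact this

variable {m n : ℕ}

/-- `x` and `y` are primal and dual feasible with the same objective value. -/
def OptimalPair (A : Matrix (Fin m) (Fin n) ℝ) (b : Fin m → ℝ) (c : Fin n → ℝ)
    (x : Fin n → ℝ) (y : Fin m → ℝ) : Prop :=
  PrimalFeasible A b x ∧ DualFeasible A c y ∧ c ⬝ᵥ x = y ⬝ᵥ b

section duality

variable {A : Matrix (Fin m) (Fin n) ℝ} {b : Fin m → ℝ} {c : Fin n → ℝ}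
  {x : Fin n → ℝ} {y : Fin m → ℝ}

/-- The duality gap is the sum of the complementarity products. -/
theorem dotProduct_sub_dotProduct (A : Matrix (Fin m) (Fin n) ℝ) (b : Fin m → ℝ) (c x : Fin n → ℝ)
    (y : Fin m → ℝ) :
    y ⬝ᵥ b - c ⬝ᵥ x = (y ᵥ* A - c) ⬝ᵥ x + y ⬝ᵥ (b - A *ᵥ x) := by
  rw [sub_dotProduct, dotProduct_sub, Matrix.dotProduct_mulVec]
  ring

theorem PrimalFeasible.slack_nonneg (hx : PrimalFeasible A b x) : 0 ≤ b - A *ᵥ x :=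
  sub_nonneg.2 hx.1

theorem DualFeasible.slack_nonneg (hy : DualFeasible A c y) : 0 ≤ y ᵥ* A - c :=
  sub_nonneg.2 hy.1

theorem weak_duality (hx : PrimalFeasible A b x) (hy : DualFeasible A c y) :
    c ⬝ᵥ x ≤ y ⬝ᵥ b := by
  have h1 := dotProduct_nonneg_of_nonneg hy.slack_nonneg hx.2
  have h2 := dotProduct_nonneg_of_nonneg hy.2 hx.slack_nonneg
  linarith [dotProduct_sub_dotProduct A b c x y]

theorem OptimalPair.complementary (h : OptimalPair A b c x y) :
    (∀ i, (y ᵥ* A - c) i * x i = 0) ∧ ∀ j, y j * (b - A *ᵥ x) j = 0 := by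
  obtain ⟨hx, hy, e⟩ := h
  have h1 := dotProduct_nonneg_of_nonneg hy.slack_nonneg hx.2
  have h2 := dotProduct_nonneg_of_nonneg hy.2 hx.slack_nonneg
  have h3 := dotProduct_sub_dotProduct A b c x y
  have h4 : (y ᵥ* A - c) ⬝ᵥ x = 0 := by linarith
  have h5 : y ⬝ᵥ (b - A *ᵥ x) = 0 := by linarith
  constructor
  · intro i
    exact (Finset.sum_eq_zero_iff_of_nonneg fun i _ =>
      mul_nonneg (hy.slack_nonneg i) (hx.2 i)).1 h4 i (Finset.mem_univ i)
  · intro j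
    exact (Finset.sum_eq_zero_iff_of_nonneg fun j _ =>
      mul_nonneg (hy.2 j) (hx.slack_nonneg j)).1 h5 j (Finset.mem_univ j)

theorem OptimalPair.of_complementary (hx : PrimalFeasible A b x) (hy : DualFeasible A c y)
    (h1 : ∀ i, (y ᵥ* A - c) i * x i = 0) (h2 : ∀ j, y j * (b - A *ᵥ x) j = 0) :
    OptimalPair A b c x y := by
  refine ⟨hx, hy, ?_⟩
  have h3 := dotProduct_sub_dotProduct A b c x y
  have h4 : (y ᵥ* A - c) ⬝ᵥ x = 0 := Finset.sum_eq_zero fun i _ => h1 i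
  have h5 : y ⬝ᵥ (b - A *ᵥ x) = 0 := Finset.sum_eq_zero fun j _ => h2 j
  linarith

/-- Strong duality: two feasible programs have an optimal pair. -/
theorem exists_optimalPair (hx : PrimalFeasible A b x) (hy : DualFeasible A c y) :
    ∃ x y, OptimalPair A b c x y := by
  -- One system in `(x, y)`: primal feasibility, dual feasibility, and the last row `y b ≤ c x`, the
  -- reverse of weak duality.
  let M : Matrix ((Fin m ⊕ Fin n) ⊕ Unit) (Fin n ⊕ Fin m) ℝ :=
    Matrix.fromRows (Matrix.fromBlocks A 0 0 (-Aᵀ)) (Matrix.of fun _ => Sum.elim (-c) b)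
  rcases farkas_le M (Sum.elim (Sum.elim b (-c)) 0) with ⟨w, hw, h⟩ | ⟨g, hg, hgM, hgb⟩
  · refine ⟨w ∘ Sum.inl, w ∘ Sum.inr, ?_⟩
    have hP : PrimalFeasible A b (w ∘ Sum.inl) := by
      refine ⟨fun j => ?_, fun i => hw _⟩
      simpa [M, Matrix.fromRows_mulVec, Matrix.fromBlocks_mulVec] using h (Sum.inl (Sum.inl j))
    have hD : DualFeasible A c (w ∘ Sum.inr) := by
      refine ⟨fun i => ?_, fun j => hw _⟩
      have := h (Sum.inl (Sum.inr i))
      simpa [M, Matrix.fromRows_mulVec, Matrix.fromBlocks_mulVec, Matrix.neg_mulVec,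
        Matrix.mulVec_transpose] using this
    refine ⟨hP, hD, le_antisymm (weak_duality hP hD) ?_⟩
    have := h (Sum.inr ())
    simp only [M, Matrix.fromRows_apply_inr, Sum.elim_inr, Matrix.mulVec, dotProduct, Matrix.of_apply,
      Fintype.sum_sum_type, Sum.elim_inl, Pi.neg_apply, neg_mul, Finset.sum_neg_distrib,
      Pi.zero_apply] at this
    simp only [dotProduct, Function.comp]
    rw [Finset.sum_congr rfl fun j _ => mul_comm (w (Sum.inr j)) (b j)]
    linarith
  · exfalso
    set p : Fin m → ℝ := fun j => g (Sum.inl (Sum.inl j)) with hp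
    set q : Fin n → ℝ := fun i => g (Sum.inl (Sum.inr i)) with hq
    set r : ℝ := g (Sum.inr ()) with hr
    have hr0 : 0 ≤ r := hg _
    have hp0 : 0 ≤ p := fun j => hg _
    have hq0 : 0 ≤ q := fun j => hg _
    have hA : r • c ≤ p ᵥ* A := by
      intro i
      have := hgM (Sum.inl i)
      simp [M, Matrix.vecMul, dotProduct] at this
      simp [Matrix.vecMul, dotProduct, hp, hr]
      linarith
    have hB : A *ᵥ q ≤ r • b := by
      intro j
      have := hgM (Sum.inr j)
      simp [M, Matrix.vecMul, dotProduct] at this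
      simp [Matrix.mulVec, dotProduct, hq, hr]
      rw [Finset.sum_congr rfl fun i _ => mul_comm (A j i) _]
      linarith
    have hval : p ⬝ᵥ b < c ⬝ᵥ q := by
      simp [dotProduct] at hgb
      simp [dotProduct, hp, hq]
      rw [Finset.sum_congr rfl fun i _ => mul_comm (c i) _]
      linarith
    -- For `r = 0`, `q` and `p` are recession directions, whose objective values are controlled by
    -- the given feasible points. For `r > 0`, weak duality applies to the data scaled by `r`.
    rcases hr0.eq_or_lt with h0 | h0
    · rw [← h0, zero_smul] at hA hB
      have h1 : 0 ≤ p ⬝ᵥ b := by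
        have a1 := dotProduct_nonneg_of_nonneg hA hx.2
        have a2 := dotProduct_nonneg_of_nonneg hp0 hx.slack_nonneg
        rw [dotProduct_sub, Matrix.dotProduct_mulVec] at a2
        linarith
      have h2 : c ⬝ᵥ q ≤ 0 := by
        have a1 := dotProduct_nonneg_of_nonneg hy.2 (sub_nonneg.2 hB)
        have a2 := dotProduct_nonneg_of_nonneg hy.slack_nonneg hq0
        rw [sub_dotProduct, ← Matrix.dotProduct_mulVec] at a2
        rw [zero_sub, dotProduct_neg] at a1
        linarith
      linarith
    · have h := weak_duality (A := A) (b := r • b) (c := r • c) (x := q) (y := p)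
        ⟨hB, hq0⟩ ⟨hA, hp0⟩
      rw [smul_dotProduct, dotProduct_smul, smul_eq_mul, smul_eq_mul] at h
      nlinarith

/-- A Farkas certificate of dual infeasibility is a recession direction of the primal along which
the objective grows without bound. -/
theorem FeasibleBounded.exists_dualFeasible (h : FeasibleBounded A b c) :
    ∃ y, DualFeasible A c y := by
  obtain ⟨⟨x, hx⟩, K, hK⟩ := h
  rcases farkas_le (-Aᵀ) (-c) with ⟨y, hy, h⟩ | ⟨g, hg, hgM, hgb⟩
  · refine ⟨y, fun i => ?_, hy⟩
    simpa [Matrix.neg_mulVec, Matrix.mulVec_transpose] using h i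
  · exfalso
    rw [Matrix.vecMul_neg, Matrix.vecMul_transpose] at hgM
    rw [dotProduct_neg, neg_lt_zero, dotProduct_comm] at hgb
    have hray : ∀ t : ℝ, 0 ≤ t → c ⬝ᵥ x + t * (c ⬝ᵥ g) ≤ K := by
      intro t ht
      have : PrimalFeasible A b (x + t • g) := by
        refine ⟨fun j => ?_, fun i => ?_⟩
        · have h1 := hx.1 j
          have h2 := hgM j
          simp only [Matrix.mulVec_add, Matrix.mulVec_smul, Pi.add_apply, Pi.smul_apply,
            smul_eq_mul, Pi.neg_apply, Pi.zero_apply] at *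
          nlinarith
        · have h1 := hx.2 i
          have h2 := hg i
          simp only [Pi.add_apply, Pi.smul_apply, smul_eq_mul, Pi.zero_apply] at *
          positivity
      have := hK ⟨_, this, rfl⟩
      simpa [dotProduct_add, dotProduct_smul] using this
    have h1 := hray 0 le_rfl
    have h2 := hray ((K - c ⬝ᵥ x + 1) / (c ⬝ᵥ g)) (div_nonneg (by linarith) hgb.le)
    rw [div_mul_cancel₀ _ hgb.ne'] at h2
    linarith

theorem OptimalPair.isPrimalOptimal (h : OptimalPair A b c x y) : IsPrimalOptimal A b c x :=
  ⟨h.1, fun _ hz => (weak_duality hz h.2.1).trans_eq h.2.2.symm⟩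

theorem OptimalPair.isDualOptimal (h : OptimalPair A b c x y) : IsDualOptimal A b c y :=
  ⟨h.2.1, fun _ hz => h.2.2.symm.trans_le (weak_duality h.1 hz)⟩

/-- The chosen optimal solutions of a feasible bounded program form an optimal pair. -/
theorem FeasibleBounded.optimalPair_star (h : FeasibleBounded A b c) :
    OptimalPair A b c (xStar A b c) (yStar A b c) := by
  obtain ⟨y, hy⟩ := h.exists_dualFeasible
  obtain ⟨x, hx⟩ := h.1
  obtain ⟨x, y, hxy⟩ := exists_optimalPair hx hy
  have hX : IsPrimalOptimal A b c (xStar A b c) := by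
    have : ∃ x, IsPrimalOptimal A b c x := ⟨x, hxy.isPrimalOptimal⟩
    rw [xStar, dif_pos this]
    exact this.choose_spec
  have hY : IsDualOptimal A b c (yStar A b c) := by
    have : ∃ y, IsDualOptimal A b c y := ⟨y, hxy.isDualOptimal⟩
    rw [yStar, dif_pos this]
    exact this.choose_spec
  refine ⟨hX.1, hY.1, le_antisymm (weak_duality hX.1 hY.1) ?_⟩
  exact (hY.2 _ hxy.2.1).trans (hxy.2.2.symm.le.trans (hX.2 _ hxy.1))

end duality

/-! ### Resampling Gaussian vectors along a line. -/

instance {k : ℕ} (a : Fin k → ℝ) (v : ℝ≥0) : IsProbabilityMeasure (gaussianVec a v) := by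
  unfold gaussianVec; infer_instance

theorem vecNorm_sq {k : ℕ} (x : Fin k → ℝ) : vecNorm x ^ 2 = x ⬝ᵥ x := by
  rw [vecNorm, EuclideanSpace.real_norm_sq_eq]
  simp [dotProduct, sq]

theorem vecNorm_nonneg {k : ℕ} (x : Fin k → ℝ) : 0 ≤ vecNorm x := norm_nonneg _

theorem charFun_map_toLp {k : ℕ} (ν : Measure (Fin k → ℝ)) (t : EuclideanSpace ℝ (Fin k)) :
    charFun (ν.map (WithLp.toLp 2)) t = ∫ x, Complex.exp ((x ⬝ᵥ t.ofLp : ℝ) * Complex.I) ∂ν := by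
  rw [charFun_apply, integral_map (Measurable.aemeasurable (by fun_prop))
    (Measurable.aestronglyMeasurable (by fun_prop))]
  simp [PiLp.inner_apply, dotProduct, mul_comm]

theorem integral_exp_dotProduct_gaussianVec {k : ℕ} (a : Fin k → ℝ) (v : ℝ≥0) (t : Fin k → ℝ) :
    ∫ x, Complex.exp ((x ⬝ᵥ t : ℝ) * Complex.I) ∂(gaussianVec a v) =
      Complex.exp ((t ⬝ᵥ a : ℝ) * Complex.I - v * (t ⬝ᵥ t : ℝ) / 2) := by
  have := charFun_map_toLp (gaussianVec a v) (WithLp.toLp 2 t)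
  simp only at this
  rw [← this, gaussianVec, charFun_pi]
  simp_rw [charFun_gaussianReal, ← Complex.exp_sum]
  congr 1
  simp only [dotProduct, Complex.ofReal_sum, Complex.ofReal_mul, Finset.sum_sub_distrib,
    Finset.sum_mul, Finset.mul_sum, Finset.sum_div]
  congr 1
  refine Finset.sum_congr rfl fun i _ => ?_
  ring

/-- Resampling a Gaussian vector along a unit direction does not change its law. -/
theorem gaussianVec_eq_map_resample {k : ℕ} (a : Fin k → ℝ) (v : ℝ≥0) (u : Fin k → ℝ)
    (hu : u ⬝ᵥ u = 1) :
    ((gaussianVec a v).prod (gaussianReal (u ⬝ᵥ a) v)).map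
      (fun p => (p.1 - (u ⬝ᵥ p.1) • u) + p.2 • u) = gaussianVec a v := by
  have hmeas : Measurable fun p : (Fin k → ℝ) × ℝ => (p.1 - (u ⬝ᵥ p.1) • u) + p.2 • u := by
    unfold dotProduct; fun_prop
  have : IsProbabilityMeasure (((gaussianVec a v).prod (gaussianReal (u ⬝ᵥ a) v)).map
      (fun p => (p.1 - (u ⬝ᵥ p.1) • u) + p.2 • u)) :=
    Measure.isProbabilityMeasure_map hmeas.aemeasurable
  refine charFun_eq_pi_iff.1 fun t => ?_
  rw [← charFun_pi (μ := fun i => gaussianReal (a i) v)]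
  change _ = charFun ((gaussianVec a v).map _) t
  rw [charFun_map_toLp, charFun_map_toLp, integral_exp_dotProduct_gaussianVec,
    integral_map hmeas.aemeasurable (Measurable.aestronglyMeasurable (by
      unfold dotProduct; fun_prop))]
  set s : Fin k → ℝ := t.ofLp
  -- In the characteristic function the old vector is tested against the part of `s` orthogonal to
  -- `u`, and the new sample against `u ⬝ᵥ s`; the squared lengths of the two parts add up to that
  -- of `s`.
  have h1 : ∀ p : (Fin k → ℝ) × ℝ,
      Complex.exp ((((p.1 - (u ⬝ᵥ p.1) • u) + p.2 • u) ⬝ᵥ s : ℝ) * Complex.I) =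
      Complex.exp ((p.1 ⬝ᵥ (s - (u ⬝ᵥ s) • u) : ℝ) * Complex.I) *
        Complex.exp ((u ⬝ᵥ s : ℝ) * p.2 * Complex.I) := fun p => by
    rw [← Complex.exp_add]
    congr 1
    rw [add_dotProduct, sub_dotProduct, smul_dotProduct, smul_dotProduct, dotProduct_sub,
      dotProduct_smul, dotProduct_comm p.1 u]
    push_cast [smul_eq_mul]
    ring
  simp_rw [h1]
  rw [integral_prod_mul (fun x : Fin k → ℝ =>
      Complex.exp ((x ⬝ᵥ (s - (u ⬝ᵥ s) • u) : ℝ) * Complex.I))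
      (fun r : ℝ => Complex.exp ((u ⬝ᵥ s : ℝ) * r * Complex.I)),
    integral_exp_dotProduct_gaussianVec, ← charFun_apply_real, charFun_gaussianReal,
    ← Complex.exp_add]
  congr 1
  simp only [sub_dotProduct, dotProduct_sub, smul_dotProduct, dotProduct_smul, smul_eq_mul, hu,
    dotProduct_comm s u]
  push_cast
  ring

/-- A set of reals without two points at distance `≥ L` has small Gaussian measure. -/
theorem gaussianReal_le_of_gap (μ : ℝ) {σ : ℝ} (hσ : 0 < σ) {L : ℝ} (T : Set ℝ)
    (hT : ∀ s ∈ T, ∀ t, L ≤ t → s + t ∉ T) :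
    gaussianReal μ (Real.toNNReal (σ ^ 2)) T ≤ ENNReal.ofReal (L / (2 * σ)) := by
  have hv : Real.toNNReal (σ ^ 2) ≠ 0 := by
    simpa using hσ.ne'
  have hpdf : ∀ x, gaussianPDF μ (Real.toNNReal (σ ^ 2)) x ≤ ENNReal.ofReal (1 / (2 * σ)) := by
    intro x
    rw [gaussianPDF]
    apply ENNReal.ofReal_le_ofReal
    rw [gaussianPDFReal, Real.coe_toNNReal _ (sq_nonneg σ), one_div]
    -- The density is at most 1/(σ√(2π)), and 2π ≥ 4.
    have h1 : 2 * σ ≤ √(2 * Real.pi * σ ^ 2) := by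
      apply Real.le_sqrt_of_sq_le
      nlinarith [Real.pi_gt_three, sq_nonneg σ]
    have h2 : Real.exp (-(x - μ) ^ 2 / (2 * σ ^ 2)) ≤ 1 := by
      rw [Real.exp_le_one_iff]
      apply div_nonpos_of_nonpos_of_nonneg <;> nlinarith [sq_nonneg (x - μ), sq_nonneg σ]
    calc _ ≤ (√(2 * Real.pi * σ ^ 2))⁻¹ * 1 := by gcongr
      _ ≤ _ := by rw [mul_one]; gcongr
  have hvol : volume T ≤ ENNReal.ofReal L := by
    refine (Real.volume_le_diam T).trans (Metric.ediam_le fun x hx y hy => ?_)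
    rw [edist_dist]
    apply ENNReal.ofReal_le_ofReal
    rw [Real.dist_eq, abs_le]
    constructor
    · by_contra! h
      exact hT x hx (y - x) (by linarith) (by simpa using hy)
    · by_contra! h
      exact hT y hy (x - y) (by linarith) (by simpa using hx)
  rw [gaussianReal_apply _ hv]
  calc _ ≤ ∫⁻ _ in T, ENNReal.ofReal (1 / (2 * σ)) := by gcongr with x; exact hpdf x
    _ = ENNReal.ofReal (1 / (2 * σ)) * volume T := by simp
    _ ≤ ENNReal.ofReal (1 / (2 * σ)) * ENNReal.ofReal L := by gcongr
    _ = _ := by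
      rw [← ENNReal.ofReal_mul (by positivity)]
      congr 1; ring

/-- A set that meets every line of direction `w` in a set of parameters without gaps `≥ θ` has
small Gaussian measure. -/
theorem gaussianVec_le_of_gap {k : ℕ} (a : Fin k → ℝ) {σ : ℝ} (hσ : 0 < σ) (θ : ℝ)
    (w : Fin k → ℝ) (B : Set (Fin k → ℝ)) (hB : MeasurableSet B)
    (hgap : ∀ p ∈ B, ∀ t, θ ≤ t → p + t • w ∉ B) :
    gaussianVec a (Real.toNNReal (σ ^ 2)) B ≤ ENNReal.ofReal (θ * vecNorm w / (2 * σ)) := by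
  by_cases hw : w = 0
  -- With `w = 0` the gap hypothesis at `t = θ` contradicts itself at any point of `B`.
  · have : B = ∅ := Set.eq_empty_of_forall_notMem fun p hp => hgap p hp θ le_rfl (by simpa [hw])
    simp [this]
  have hpos : 0 < vecNorm w := by
    rw [vecNorm, norm_pos_iff]
    simpa using hw
  set u : Fin k → ℝ := (vecNorm w)⁻¹ • w with hu_def
  have hwu : w = vecNorm w • u := by rw [hu_def, smul_smul, mul_inv_cancel₀ hpos.ne', one_smul]
  have hu : u ⬝ᵥ u = 1 := by
    rw [hu_def, smul_dotProduct, dotProduct_smul, ← vecNorm_sq]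
    simp only [smul_eq_mul]
    field_simp
  have hmeas : Measurable fun p : (Fin k → ℝ) × ℝ => (p.1 - (u ⬝ᵥ p.1) • u) + p.2 • u := by
    unfold dotProduct; fun_prop
  rw [← gaussianVec_eq_map_resample a _ u hu, Measure.map_apply hmeas hB,
    Measure.prod_apply (hmeas hB)]
  refine (lintegral_mono (g := fun _ => ENNReal.ofReal (θ * vecNorm w / (2 * σ)))
    fun x => ?_).trans (by simp)
  refine gaussianReal_le_of_gap _ hσ _ fun s hs t ht h => ?_
  refine hgap _ hs (t / vecNorm w) ((le_div_iff₀ hpos).2 ht) ?_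
  rw [Set.mem_preimage, Set.mem_preimage] at h
  convert h using 1
  rw [hwu, smul_smul, ← hwu, div_mul_cancel₀ _ hpos.ne', add_assoc, ← add_smul]

/-! ### Optimal pairs under perturbation of the right-hand side and the objective. -/

section perturbation

variable {A : Matrix (Fin m) (Fin n) ℝ} {b : Fin m → ℝ} {c : Fin n → ℝ}
  {x x' : Fin n → ℝ} {y y' : Fin m → ℝ} {t r : ℝ}

/-- Moving `b` along the column of a positive variable moves the optimal solution. -/
theorem OptimalPair.add_col (h : OptimalPair A b c x y) (i : Fin n) (hi : 0 < x i) (ht : 0 ≤ t) :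
    OptimalPair A (b + t • A.col i) c (x + t • Pi.single i 1) y := by
  -- The slacks do not change, so complementarity survives with the same `y`.
  have hs : b + t • A.col i - A *ᵥ (x + t • Pi.single i 1) = b - A *ᵥ x := by
    rw [Matrix.mulVec_add, Matrix.mulVec_smul, Matrix.mulVec_single_one]
    abel
  obtain ⟨h1, h2⟩ := h.complementary
  refine .of_complementary ⟨sub_nonneg.1 (hs ▸ h.1.slack_nonneg), ?_⟩ h.2.1 (fun l => ?_)
    (fun j => by rw [hs]; exact h2 j)
  · exact add_nonneg h.1.2 (smul_nonneg ht (Pi.single_nonneg.2 zero_le_one))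
  · by_cases hl : l = i
    · subst hl
      rw [(mul_eq_zero.1 (h1 l)).resolve_right hi.ne', zero_mul]
    · simpa [hl] using h1 l

/-- Relaxing a constraint that is not tight keeps the optimal solutions. -/
theorem OptimalPair.relax (h : OptimalPair A b c x y) (j : Fin m) (hj : 0 < (b - A *ᵥ x) j)
    (ht : 0 ≤ t) : OptimalPair A (b + t • Pi.single j 1) c x y := by
  obtain ⟨h1, h2⟩ := h.complementary
  refine .of_complementary ⟨h.1.1.trans ?_, h.1.2⟩ h.2.1 h1 fun l => ?_
  · exact le_add_of_nonneg_right (smul_nonneg ht (Pi.single_nonneg.2 zero_le_one))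
  · by_cases hl : l = j
    · subst hl
      rw [(mul_eq_zero.1 (h2 l)).resolve_right hj.ne', zero_mul]
    · simpa [hl] using h2 l

/-- Lowering the objective coefficient of a vanishing variable keeps the optimal solutions. -/
theorem OptimalPair.sub_single (h : OptimalPair A b c x y) (i : Fin n) (hi : x i = 0)
    (ht : 0 ≤ t) : OptimalPair A b (c - t • Pi.single i 1) x y := by
  obtain ⟨h1, h2⟩ := h.complementary
  refine .of_complementary h.1 ⟨le_trans ?_ h.2.1.1, h.2.1.2⟩ (fun l => ?_) h2
  · exact sub_le_self _ (smul_nonneg ht (Pi.single_nonneg.2 zero_le_one))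
  · by_cases hl : l = i
    · subst hl
      rw [hi, mul_zero]
    · simpa [hl] using h1 l

/-- Moving `c` along the row of a positive dual variable moves the dual optimal solution. -/
theorem OptimalPair.add_row (h : OptimalPair A b c x y) (j : Fin m) (hj : 0 < y j) (ht : 0 ≤ t) :
    OptimalPair A b (c + t • A.row j) x (y + t • Pi.single j 1) := by
  have hs : (y + t • Pi.single j 1) ᵥ* A - (c + t • A.row j) = y ᵥ* A - c := by
    rw [Matrix.add_vecMul, Matrix.smul_vecMul, Matrix.single_one_vecMul]
    abel
  obtain ⟨h1, h2⟩ := h.complementary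
  refine .of_complementary h.1 ⟨sub_nonneg.1 (hs ▸ h.2.1.slack_nonneg), ?_⟩
    (fun i => by rw [hs]; exact h1 i) (fun l => ?_)
  · exact add_nonneg h.2.1.2 (smul_nonneg ht (Pi.single_nonneg.2 zero_le_one))
  · by_cases hl : l = j
    · subst hl
      rw [(mul_eq_zero.1 (h2 l)).resolve_left hj.ne', mul_zero]
    · simpa [hl] using h2 l

/-- Optimal values of a linear functional are monotone when the objective moves along it. -/
theorem OptimalPair.dotProduct_mono {a : Fin n → ℝ} (h : OptimalPair A b c x y)
    (h' : OptimalPair A b (c + r • a) x' y') (hr : 0 < r) : a ⬝ᵥ x ≤ a ⬝ᵥ x' := by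
  have h1 := h.isPrimalOptimal.2 _ h'.1
  have h2 := h'.isPrimalOptimal.2 _ h.1
  simp only [add_dotProduct, smul_dotProduct, smul_eq_mul] at h2
  nlinarith

/-- The optimal `x i` is monotone in its own coefficient. The pair at the far end `t` only supplies
dual feasibility, hence existence of an optimum, at the intermediate `r`. -/
theorem OptimalPair.exists_pos_of_le (h : OptimalPair A b c x y) (i : Fin n) (hi : 0 < x i)
    (h' : OptimalPair A b (c + t • Pi.single i 1) x' y') (hr : 0 ≤ r) (hrt : r ≤ t) :
    ∃ x y, OptimalPair A b (c + r • Pi.single i 1) x y ∧ 0 < x i := by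
  rcases hr.eq_or_lt with rfl | hr
  · exact ⟨x, y, by simpa using h, hi⟩
  have hD : DualFeasible A (c + r • Pi.single i 1) y' := by
    refine ⟨le_trans ?_ h'.2.1.1, h'.2.1.2⟩
    have : (0 : Fin n → ℝ) ≤ Pi.single i 1 := Pi.single_nonneg.2 zero_le_one
    gcongr
  obtain ⟨u, v, huv⟩ := exists_optimalPair h.1 hD
  refine ⟨u, v, huv, hi.trans_le ?_⟩
  simpa using h.dotProduct_mono huv hr

/-- Moving the objective against row `j` cannot increase the value of that row at the optimum. Dual
feasibility at `r` comes from `y'` by adding `t - r` to its coordinate `j`. -/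
theorem OptimalPair.exists_slack_pos_of_le (h : OptimalPair A b c x y) (j : Fin m)
    (hj : 0 < (b - A *ᵥ x) j) (h' : OptimalPair A b (c - t • A.row j) x' y')
    (hr : 0 ≤ r) (hrt : r ≤ t) :
    ∃ x y, OptimalPair A b (c - r • A.row j) x y ∧ 0 < (b - A *ᵥ x) j := by
  rcases hr.eq_or_lt with rfl | hr
  · exact ⟨x, y, by simpa using h, hj⟩
  have hD : DualFeasible A (c - r • A.row j) (y' + (t - r) • Pi.single j 1) := by
    constructor
    · rw [Matrix.add_vecMul, Matrix.smul_vecMul, Matrix.single_one_vecMul]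
      have := h'.2.1.1
      calc c - r • A.row j = c - t • A.row j + (t - r) • A.row j := by rw [sub_smul]; abel
        _ ≤ _ := by gcongr
    · exact add_nonneg h'.2.1.2 (smul_nonneg (sub_nonneg.2 hrt) (Pi.single_nonneg.2 zero_le_one))
  obtain ⟨u, v, huv⟩ := exists_optimalPair h.1 hD
  refine ⟨u, v, huv, hj.trans_le ?_⟩
  have huv' : OptimalPair A b (c + r • (-A.row j)) u v := by
    rwa [smul_neg, ← sub_eq_add_neg]
  have := h.dotProduct_mono huv' hr
  rw [neg_dotProduct, neg_dotProduct, neg_le_neg_iff] at this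
  exact sub_le_sub_left this (b j)

end perturbation

/-! ### Norms of rows and columns. -/

section norms

theorem vecNorm_mulVec_le (A : Matrix (Fin m) (Fin n) ℝ) (x : Fin n → ℝ) :
    vecNorm (A *ᵥ x) ≤ opNorm A * vecNorm x := by
  have := (LinearMap.toContinuousLinearMap (Matrix.toEuclideanLin A)).le_opNorm (WithLp.toLp 2 x)
  simpa [Matrix.toLpLin_toLp] using! this

theorem opNorm_nonneg (A : Matrix (Fin m) (Fin n) ℝ) : 0 ≤ opNorm A := norm_nonneg _

theorem vecNorm_single (i : Fin n) : vecNorm (Pi.single i (1 : ℝ)) = 1 := by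
  have := vecNorm_sq (Pi.single i (1 : ℝ))
  rw [single_dotProduct, Pi.single_eq_same, mul_one] at this
  exact (pow_eq_one_iff_of_nonneg (vecNorm_nonneg _) two_ne_zero).1 this

theorem vecNorm_col_le (A : Matrix (Fin m) (Fin n) ℝ) (i : Fin n) :
    vecNorm (A.col i) ≤ opNorm A := by
  simpa [vecNorm_single] using vecNorm_mulVec_le A (Pi.single i 1)

theorem abs_le_vecNorm (x : Fin n → ℝ) (i : Fin n) : |x i| ≤ vecNorm x := by
  simpa [vecNorm] using PiLp.norm_apply_le (WithLp.toLp 2 x) i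

theorem vecNorm_row_le (A : Matrix (Fin m) (Fin n) ℝ) (j : Fin m) :
    vecNorm (A.row j) ≤ opNorm A := by
  -- Coordinate `j` of `A` applied to its own row `j` is the squared norm of that row.
  have h1 : A.row j ⬝ᵥ A.row j ≤ opNorm A * vecNorm (A.row j) :=
    (le_abs_self _).trans ((abs_le_vecNorm (A *ᵥ A.row j) j).trans (vecNorm_mulVec_le _ _))
  rw [← vecNorm_sq, sq] at h1
  rcases (vecNorm_nonneg (A.row j)).eq_or_lt with h | h
  · rw [← h]; exact opNorm_nonneg A
  · exact le_of_mul_le_mul_right h1 h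

theorem vecNorm_neg (x : Fin n → ℝ) : vecNorm (-x) = vecNorm x := by
  simp [vecNorm]

end norms

/-! ### Measurability of events about optimal pairs. -/

section measurability

/-- Projections of intersections of closed and open conditions are measurable in `σ`-compact
spaces. -/
theorem measurableSet_exists_pos {X Y : Type*} [TopologicalSpace X] [TopologicalSpace Y] [T2Space X]
    [MeasurableSpace X] [BorelSpace X] [SigmaCompactSpace X] [SigmaCompactSpace Y]
    {C : Set (X × Y)} (hC : IsClosed C) {g : X × Y → ℝ} (hg : Continuous g) :
    MeasurableSet {p | ∃ q, (p, q) ∈ C ∧ 0 < g (p, q)} := by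
  -- Writing `0 < g` as a union of closed conditions `1/(k+1) ≤ g` and exhausting by compact sets
  -- makes the projection a countable union of compact sets.
  have : {p | ∃ q, (p, q) ∈ C ∧ 0 < g (p, q)} = ⋃ k : ℕ, ⋃ l : ℕ,
      Prod.fst '' (compactCovering (X × Y) l ∩ (C ∩ {z | 1 / ((k : ℝ) + 1) ≤ g z})) := by
    ext p
    simp only [Set.mem_ofPred_eq, Set.mem_iUnion, Set.mem_image]
    constructor
    · rintro ⟨q, hq, hpos⟩
      obtain ⟨k, hk⟩ := exists_nat_one_div_lt hpos
      obtain ⟨l, hl⟩ := exists_mem_compactCovering (p, q)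
      exact ⟨k, l, (p, q), ⟨hl, hq, hk.le⟩, rfl⟩
    · rintro ⟨k, l, ⟨p, q⟩, ⟨-, hq, hk⟩, rfl⟩
      exact ⟨q, hq, Nat.one_div_pos_of_nat.trans_le hk⟩
  rw [this]
  refine MeasurableSet.iUnion fun k => MeasurableSet.iUnion fun l => ?_
  exact (((isCompact_compactCovering _ l).inter_right
    (hC.inter (isClosed_le continuous_const hg))).image continuous_fst).isClosed.measurableSet

theorem measurableSet_exists_mem {X Y : Type*} [TopologicalSpace X] [TopologicalSpace Y] [T2Space X]
    [MeasurableSpace X] [BorelSpace X] [SigmaCompactSpace X] [SigmaCompactSpace Y]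
    {C : Set (X × Y)} (hC : IsClosed C) : MeasurableSet {p | ∃ q, (p, q) ∈ C} := by
  simpa using measurableSet_exists_pos hC (g := fun _ => 1) continuous_const

end measurability

/-- The data of a linear program, with the constraint matrix as an array of entries. -/
abbrev Data (m n : ℕ) := (Fin m → Fin n → ℝ) × (Fin m → ℝ) × (Fin n → ℝ)

/-- `x` and `y` form an optimal pair for the program with data `P`. -/
def Data.Opt (P : Data m n) (x : Fin n → ℝ) (y : Fin m → ℝ) : Prop :=
  OptimalPair (Matrix.of P.1) P.2.1 P.2.2 x y

/-- The slack of the `j`-th primal constraint. -/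
def Data.primalSlack (P : Data m n) (x : Fin n → ℝ) (j : Fin m) : ℝ :=
  (P.2.1 - Matrix.of P.1 *ᵥ x) j

/-- The slack of the `i`-th dual constraint. -/
def Data.dualSlack (P : Data m n) (y : Fin m → ℝ) (i : Fin n) : ℝ :=
  (y ᵥ* Matrix.of P.1 - P.2.2) i

/-- A scale that dominates the norms of the rows and columns of the constraint matrix. -/
noncomputable def scale (A : Fin m → Fin n → ℝ) : ℝ := opNorm (Matrix.of A) + 3

theorem three_le_scale (A : Fin m → Fin n → ℝ) : 3 ≤ scale A := by
  have := opNorm_nonneg (Matrix.of A)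
  unfold scale; linarith

theorem scale_pos (A : Fin m → Fin n → ℝ) : 0 < scale A := by
  linarith [three_le_scale A]

theorem continuous_scale : Continuous (scale : (Fin m → Fin n → ℝ) → ℝ) := by
  have h1 : Continuous fun A : Fin m → Fin n → ℝ =>
      LinearMap.toContinuousLinearMap (Matrix.toEuclideanLin (Matrix.of A)) :=
    (((Matrix.ofLinearEquiv ℝ : (Fin m → Fin n → ℝ) ≃ₗ[ℝ] Matrix (Fin m) (Fin n) ℝ).trans
      (Matrix.toEuclideanLin.trans LinearMap.toContinuousLinearMap)).toLinearMap
      ).continuous_of_finiteDimensional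
  exact h1.norm.add continuous_const

theorem continuous_primalSlack (j : Fin m) : Continuous
    fun q : Data m n × (Fin n → ℝ) × (Fin m → ℝ) => q.1.primalSlack q.2.1 j := by
  simp only [Data.primalSlack, Pi.sub_apply, Matrix.mulVec, dotProduct, Matrix.of_apply]
  fun_prop

theorem continuous_dualSlack (i : Fin n) : Continuous
    fun q : Data m n × (Fin n → ℝ) × (Fin m → ℝ) => q.1.dualSlack q.2.2 i := by
  simp only [Data.dualSlack, Pi.sub_apply, Matrix.vecMul, dotProduct, Matrix.of_apply]
  fun_prop

theorem isClosed_opt :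
    IsClosed {q : Data m n × (Fin n → ℝ) × (Fin m → ℝ) | q.1.Opt q.2.1 q.2.2} := by
  have : {q : Data m n × (Fin n → ℝ) × (Fin m → ℝ) | q.1.Opt q.2.1 q.2.2} =
      ({q | ∀ j, 0 ≤ q.1.primalSlack q.2.1 j} ∩ {q | ∀ i, 0 ≤ q.2.1 i}) ∩
      (({q | ∀ i, 0 ≤ q.1.dualSlack q.2.2 i} ∩ {q | ∀ j, 0 ≤ q.2.2 j}) ∩
        {q | q.1.2.2 ⬝ᵥ q.2.1 = q.2.2 ⬝ᵥ q.1.2.1}) := by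
    ext q
    simp [Data.Opt, OptimalPair, PrimalFeasible, DualFeasible, Data.primalSlack, Data.dualSlack,
      Pi.le_def]
  rw [this]
  simp only [Set.ofPred_forall]
  refine .inter (.inter ?_ ?_) (.inter (.inter ?_ ?_) ?_)
  · exact isClosed_iInter fun j => isClosed_le continuous_const (continuous_primalSlack j)
  · exact isClosed_iInter fun j => isClosed_le continuous_const (by fun_prop)
  · exact isClosed_iInter fun j => isClosed_le continuous_const (continuous_dualSlack j)
  · exact isClosed_iInter fun j => isClosed_le continuous_const (by fun_prop)
  · exact isClosed_eq (by unfold dotProduct; fun_prop) (by unfold dotProduct; fun_prop)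

theorem measurableSet_exists_opt_pos
    {g : Data m n × (Fin n → ℝ) × (Fin m → ℝ) → ℝ} (hg : Continuous g) :
    MeasurableSet {P : Data m n | ∃ x y, P.Opt x y ∧ 0 < g (P, x, y)} := by
  simpa using measurableSet_exists_pos isClosed_opt hg

theorem measurableSet_exists_opt_le
    {g g' : Data m n × (Fin n → ℝ) × (Fin m → ℝ) → ℝ} (hg : Continuous g) (hg' : Continuous g') :
    MeasurableSet {P : Data m n | ∃ x y, P.Opt x y ∧ g (P, x, y) ≤ g' (P, x, y)} := by
  simpa using measurableSet_exists_mem (isClosed_opt.inter (isClosed_le hg hg'))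

/-! ### From gaps along lines to probabilities of programs. -/

section probability

variable {A₀ : Matrix (Fin m) (Fin n) ℝ} {b₀ : Fin m → ℝ} {c₀ : Fin n → ℝ} {σ : ℝ}

instance (v : ℝ≥0) : IsProbabilityMeasure (gaussianMat A₀ v) := by
  unfold gaussianMat
  have (i : Fin m) : IsProbabilityMeasure (gaussianVec (A₀ i) v) := inferInstance
  exact Measure.pi.instIsProbabilityMeasure _

instance (v : ℝ≥0) : IsProbabilityMeasure (gaussianLP A₀ b₀ c₀ v) := by
  unfold gaussianLP; infer_instance

theorem gaussianLP_le_of_forall_rhs {v : ℝ≥0} {B : Set (Data m n)} (hB : MeasurableSet B)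
    {K : ℝ≥0∞} (h : ∀ A c, gaussianVec b₀ v {b | (A, b, c) ∈ B} ≤ K) :
    gaussianLP A₀ b₀ c₀ v B ≤ K := by
  rw [gaussianLP, Measure.prod_apply hB]
  refine (lintegral_mono (g := fun _ => K) fun A => ?_).trans (by simp)
  rw [Measure.prod_apply_symm (measurable_prodMk_left hB)]
  exact (lintegral_mono (g := fun _ => K) fun c => h A c).trans (by simp)

theorem gaussianLP_le_of_forall_obj {v : ℝ≥0} {B : Set (Data m n)} (hB : MeasurableSet B)
    {K : ℝ≥0∞} (h : ∀ A b, gaussianVec c₀ v {c | (A, b, c) ∈ B} ≤ K) :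
    gaussianLP A₀ b₀ c₀ v B ≤ K := by
  rw [gaussianLP, Measure.prod_apply hB]
  refine (lintegral_mono (g := fun _ => K) fun A => ?_).trans (by simp)
  rw [Measure.prod_apply (measurable_prodMk_left hB)]
  exact (lintegral_mono (g := fun _ => K) fun b => h A b).trans (by simp)

theorem div_scale_mul_le {η : ℝ} (hσ : 0 < σ) (hη : 0 ≤ η) (A : Fin m → Fin n → ℝ) {r : ℝ}
    (hr : r ≤ scale A) : η / scale A * r / (2 * σ) ≤ η / (2 * σ) := by
  have := scale_pos A
  gcongr
  rw [div_mul_eq_mul_div, div_le_iff₀ this]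
  gcongr

/-- Conditioning on `A` and `c` allows the gap and the direction to depend on `A`; the gap `η /
scale A` cancels the norm of the direction, leaving a bound uniform in `A`. -/
theorem gaussianLP_le_of_rhs_gap (hσ : 0 < σ) {η : ℝ} (hη : 0 ≤ η) {B : Set (Data m n)}
    (hB : MeasurableSet B) (w : (Fin m → Fin n → ℝ) → Fin m → ℝ)
    (hw : ∀ A, vecNorm (w A) ≤ scale A)
    (hgap : ∀ A b c, (A, b, c) ∈ B → ∀ t, η / scale A ≤ t → (A, b + t • w A, c) ∉ B) :
    gaussianLP A₀ b₀ c₀ (Real.toNNReal (σ ^ 2)) B ≤ ENNReal.ofReal (η / (2 * σ)) := by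
  refine gaussianLP_le_of_forall_rhs hB fun A c => ?_
  refine (gaussianVec_le_of_gap b₀ hσ (η / scale A) (w A) _ ?_ fun b hb t ht =>
    hgap A b c hb t ht).trans (ENNReal.ofReal_le_ofReal (div_scale_mul_le hσ hη A (hw A)))
  have : Measurable fun b : Fin m → ℝ => ((A, b, c) : Data m n) := by fun_prop
  exact this hB

theorem gaussianLP_le_of_obj_gap (hσ : 0 < σ) {η : ℝ} (hη : 0 ≤ η) {B : Set (Data m n)}
    (hB : MeasurableSet B) (w : (Fin m → Fin n → ℝ) → Fin n → ℝ)
    (hw : ∀ A, vecNorm (w A) ≤ scale A)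
    (hgap : ∀ A b c, (A, b, c) ∈ B → ∀ t, η / scale A ≤ t → (A, b, c + t • w A) ∉ B) :
    gaussianLP A₀ b₀ c₀ (Real.toNNReal (σ ^ 2)) B ≤ ENNReal.ofReal (η / (2 * σ)) := by
  refine gaussianLP_le_of_forall_obj hB fun A b => ?_
  refine (gaussianVec_le_of_gap c₀ hσ (η / scale A) (w A) _ ?_ fun c hc t ht =>
    hgap A b c hc t ht).trans (ENNReal.ofReal_le_ofReal (div_scale_mul_le hσ hη A (hw A)))
  have : Measurable fun c : Fin n → ℝ => ((A, b, c) : Data m n) := by fun_prop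
  exact this hB

/-- Affine slices with too few nonzero coordinates are Gaussian null sets. -/
theorem gaussianVec_sparse {k l : ℕ} (a : Fin k → ℝ) (hσ : 0 < σ) (M : Matrix (Fin k) (Fin l) ℝ)
    (U : Finset (Fin l)) (W : Finset (Fin k)) (hcard : U.card + W.card < k) :
    gaussianVec a (Real.toNNReal (σ ^ 2)) {v | ∃ x s, (∀ i, i ∉ U → x i = 0) ∧
      (∀ j, j ∉ W → s j = 0) ∧ v = M *ᵥ x + s} = 0 := by
  classical
  let f : (U → ℝ) × (W → ℝ) →ₗ[ℝ] (Fin k → ℝ) :=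
    (M.mulVecLin ∘ₗ Function.ExtendByZero.linearMap ℝ (Subtype.val : U → Fin l)).coprod
      (Function.ExtendByZero.linearMap ℝ (Subtype.val : W → Fin k))
  have hne : LinearMap.range f ≠ ⊤ := by
    intro h
    have h1 := LinearMap.finrank_range_le f
    rw [h, finrank_top, Module.finrank_prod, Module.finrank_fintype_fun_eq_card,
      Module.finrank_fintype_fun_eq_card, Module.finrank_fintype_fun_eq_card] at h1
    simp at h1
    omega
  have hsub : {v | ∃ x s, (∀ i, i ∉ U → x i = 0) ∧
      (∀ j, j ∉ W → s j = 0) ∧ v = M *ᵥ x + s} ⊆ (LinearMap.range f : Set (Fin k → ℝ)) := by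
    rintro v ⟨x, s, hx, hs, rfl⟩
    have ext : ∀ {q : ℕ} (S : Finset (Fin q)) (z : Fin q → ℝ), (∀ i, i ∉ S → z i = 0) →
        Function.ExtendByZero.linearMap ℝ (Subtype.val : S → Fin q) (fun i => z i) = z := by
      intro q S z hz
      ext i
      by_cases hi : i ∈ S
      · exact Subtype.val_injective.extend_apply (fun i : S => z i) 0 (⟨i, hi⟩ : S)
      · rw [hz i hi]
        exact Function.extend_apply' (f := Subtype.val) (fun i : S => z i) (0 : Fin q → ℝ) i
          (by rintro ⟨⟨_, h⟩, rfl⟩; exact hi h)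
    refine ⟨(fun i => x i, fun j => s j), ?_⟩
    simp [f, ext U x hx, ext W s hs]
  obtain ⟨w, hw⟩ : ∃ w, w ∉ LinearMap.range f := by
    by_contra! h
    exact hne (eq_top_iff.2 fun w _ => h w)
  refine le_antisymm ((measure_mono hsub).trans ?_) bot_le
  -- A line in a direction outside a subspace meets it at most once, so every positive `θ` is an
  -- admissible gap.
  have hbound : ∀ θ : ℝ, 0 < θ → gaussianVec a (Real.toNNReal (σ ^ 2)) (LinearMap.range f) ≤
      ENNReal.ofReal (θ * vecNorm w / (2 * σ)) := fun θ hθ => by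
    refine gaussianVec_le_of_gap a hσ θ w _
      (Submodule.closed_of_finiteDimensional _).measurableSet fun p hp t ht h => hw ?_
    have h2 : t • w ∈ LinearMap.range f := by simpa using Submodule.sub_mem _ h hp
    exact (Submodule.smul_mem_iff _ (hθ.trans_le ht).ne').1 h2
  have hlim : Filter.Tendsto (fun θ : ℝ => ENNReal.ofReal (θ * vecNorm w / (2 * σ)))
      (nhdsWithin 0 (Set.Ioi 0)) (nhds 0) := by
    have : Filter.Tendsto (fun θ : ℝ => ENNReal.ofReal (θ * vecNorm w / (2 * σ)))
      (nhds 0) (nhds (ENNReal.ofReal (0 * vecNorm w / (2 * σ)))) :=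
      (ENNReal.continuous_ofReal.comp (by fun_prop)).tendsto 0
    simp only [zero_mul, zero_div, ENNReal.ofReal_zero] at this
    exact this.mono_left nhdsWithin_le_nhds
  exact ge_of_tendsto hlim (Filter.eventually_of_mem self_mem_nhdsWithin hbound)

end probability

/-! ### The bad events, their measurability and their probabilities. -/

/-- Lower the objective coefficient of the variable `i` by `η / scale A`. -/
noncomputable def Data.lower (η : ℝ) (i : Fin n) (P : Data m n) : Data m n :=
  (P.1, P.2.1, P.2.2 - (η / scale P.1) • Pi.single i 1)

/-- Move the objective by `η / scale A` times the `j`-th row of the constraint matrix. -/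
noncomputable def Data.raise (η : ℝ) (j : Fin m) (P : Data m n) : Data m n :=
  (P.1, P.2.1, P.2.2 + (η / scale P.1) • (Matrix.of P.1).row j)

/-- Quantifying over all optimal pairs, here and below, avoids both the arbitrary choice in `xStar`
and any appeal to uniqueness of the optimum. -/
def posVar (i : Fin n) : Set (Data m n) := {P | ∃ x y, P.Opt x y ∧ 0 < x i}

def posSlack (j : Fin m) : Set (Data m n) := {P | ∃ x y, P.Opt x y ∧ 0 < P.primalSlack x j}

/-- The variable `i` vanishes, and its dual slack is small. -/
def smallDualSlack (η : ℝ) (i : Fin n) : Set (Data m n) :=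
  {P | ∃ x y, P.Opt x y ∧ x i ≤ 0} \ {P | ∃ x y, P.Opt x y ∧ η / scale P.1 ≤ P.dualSlack y i}

/-- The dual variable `j` is positive and small. -/
def smallDualVar (η : ℝ) (j : Fin m) : Set (Data m n) :=
  {P | ∃ x y, P.Opt x y ∧ 0 < y j} \ {P | ∃ x y, P.Opt x y ∧ η / scale P.1 ≤ y j}

/-- The primal variable `i` is positive, but stops being so when its coefficient is lowered. -/
def unstableVar (η : ℝ) (i : Fin n) : Set (Data m n) :=
  posVar i \ Data.lower η i ⁻¹' posVar i

/-- The constraint `j` has positive slack, but loses it when the objective is moved. -/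
def unstableSlack (η : ℝ) (j : Fin m) : Set (Data m n) :=
  posSlack j \ Data.raise η j ⁻¹' posSlack j

/-- The primal variable `i` is positive and small after lowering its coefficient. -/
def smallVar (η : ℝ) (i : Fin n) : Set (Data m n) :=
  Data.lower η i ⁻¹' (posVar i \ {P | ∃ x y, P.Opt x y ∧ η / scale P.1 ≤ x i})

/-- The constraint `j` has small positive slack after moving the objective. -/
def smallSlack (η : ℝ) (j : Fin m) : Set (Data m n) :=
  Data.raise η j ⁻¹' (posSlack j \ {P | ∃ x y, P.Opt x y ∧ η / scale P.1 ≤ P.primalSlack x j})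

section measurability

theorem continuous_div_scale {X : Type*} [TopologicalSpace X] (η : ℝ)
    {f : X → Fin m → Fin n → ℝ} (hf : Continuous f) : Continuous fun q => η / scale (f q) :=
  continuous_const.div (continuous_scale.comp hf) fun _ => (scale_pos _).ne'

theorem measurable_lower (η : ℝ) (i : Fin n) : Measurable (Data.lower (m := m) η i) := by
  have := continuous_div_scale (m := m) (n := n) η
    (f := fun P : Data m n => P.1) continuous_fst
  have h : Continuous (Data.lower (m := m) η i) := by unfold Data.lower; fun_prop
  exact h.measurable

theorem measurable_raise (η : ℝ) (j : Fin m) : Measurable (Data.raise (n := n) η j) := by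
  have := continuous_div_scale (m := m) (n := n) η
    (f := fun P : Data m n => P.1) continuous_fst
  have h2 : Continuous fun P : Data m n => (Matrix.of P.1).row j := by
    change Continuous fun P : Data m n => P.1 j
    fun_prop
  have h : Continuous (Data.raise (n := n) η j) := by unfold Data.raise; fun_prop
  exact h.measurable

theorem measurableSet_posVar (i : Fin n) : MeasurableSet (posVar (m := m) i) :=
  measurableSet_exists_opt_pos (g := fun q => q.2.1 i) (by fun_prop)

theorem measurableSet_posSlack (j : Fin m) : MeasurableSet (posSlack (n := n) j) :=
  measurableSet_exists_opt_pos (g := fun q => q.1.primalSlack q.2.1 j) (continuous_primalSlack j)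

theorem measurableSet_smallDualSlack (η : ℝ) (i : Fin n) :
    MeasurableSet (smallDualSlack (m := m) η i) :=
  (measurableSet_exists_opt_le (g := fun q => q.2.1 i) (g' := fun _ => 0)
    (by fun_prop) continuous_const).diff
  (measurableSet_exists_opt_le (g := fun q => η / scale q.1.1) (g' := fun q => q.1.dualSlack q.2.2 i)
    (continuous_div_scale η (by fun_prop)) (continuous_dualSlack i))

theorem measurableSet_smallDualVar (η : ℝ) (j : Fin m) :
    MeasurableSet (smallDualVar (n := n) η j) :=
  (measurableSet_exists_opt_pos (g := fun q => q.2.2 j) (by fun_prop)).diff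
  (measurableSet_exists_opt_le (g := fun q => η / scale q.1.1) (g' := fun q => q.2.2 j)
    (continuous_div_scale η (by fun_prop)) (by fun_prop))

theorem measurableSet_unstableVar (η : ℝ) (i : Fin n) :
    MeasurableSet (unstableVar (m := m) η i) :=
  (measurableSet_posVar i).diff (measurable_lower η i (measurableSet_posVar i))

theorem measurableSet_unstableSlack (η : ℝ) (j : Fin m) :
    MeasurableSet (unstableSlack (n := n) η j) :=
  (measurableSet_posSlack j).diff (measurable_raise η j (measurableSet_posSlack j))

theorem measurableSet_smallVar (η : ℝ) (i : Fin n) : MeasurableSet (smallVar (m := m) η i) :=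
  measurable_lower η i ((measurableSet_posVar i).diff
    (measurableSet_exists_opt_le (g := fun q => η / scale q.1.1) (g' := fun q => q.2.1 i)
      (continuous_div_scale η (by fun_prop)) (by fun_prop)))

theorem measurableSet_smallSlack (η : ℝ) (j : Fin m) : MeasurableSet (smallSlack (n := n) η j) :=
  measurable_raise η j ((measurableSet_posSlack j).diff
    (measurableSet_exists_opt_le (g := fun q => η / scale q.1.1)
      (g' := fun q => q.1.primalSlack q.2.1 j)
      (continuous_div_scale η (by fun_prop)) (continuous_primalSlack j)))

end measurability

section probability

variable (A₀ : Matrix (Fin m) (Fin n) ℝ) (b₀ : Fin m → ℝ) (c₀ : Fin n → ℝ) {σ η : ℝ}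

theorem vecNorm_single_le_scale {k : ℕ} (i : Fin k) (A : Fin m → Fin n → ℝ) :
    vecNorm (Pi.single i (1 : ℝ)) ≤ scale A := by
  rw [vecNorm_single]; linarith [three_le_scale A]

theorem vecNorm_row_le_scale (A : Fin m → Fin n → ℝ) (j : Fin m) :
    vecNorm ((Matrix.of A).row j) ≤ scale A := by
  have := vecNorm_row_le (Matrix.of A) j
  unfold scale; linarith

theorem vecNorm_col_le_scale (A : Fin m → Fin n → ℝ) (i : Fin n) :
    vecNorm ((Matrix.of A).col i) ≤ scale A := by
  have := vecNorm_col_le (Matrix.of A) i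
  unfold scale; linarith

/-- Lowering the coefficient of a vanishing variable by `t` keeps the pair optimal and raises its
dual slack by `t`. -/
theorem gaussianLP_smallDualSlack (hσ : 0 < σ) (hη : 0 ≤ η) (i : Fin n) :
    gaussianLP A₀ b₀ c₀ (Real.toNNReal (σ ^ 2)) (smallDualSlack η i) ≤
      ENNReal.ofReal (η / (2 * σ)) := by
  refine gaussianLP_le_of_obj_gap hσ hη (measurableSet_smallDualSlack η i)
    (fun _ => -Pi.single i 1) (fun A => ?_) ?_
  · rw [vecNorm_neg]; exact vecNorm_single_le_scale i A
  · rintro A b c ⟨⟨x, y, h, hi⟩, -⟩ t ht ⟨-, hn⟩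
    have ht0 : 0 ≤ t := (div_nonneg hη (scale_pos A).le).trans ht
    have hx : x i = 0 := le_antisymm hi (h.1.2 i)
    have h' := OptimalPair.sub_single h i hx ht0
    refine hn ⟨x, y, ?_, ?_⟩
    · simpa only [Data.Opt, smul_neg, ← sub_eq_add_neg] using h'
    · have h3 := h.2.1.slack_nonneg i
      simp [Data.dualSlack] at h3 ⊢
      linarith

theorem gaussianLP_smallDualVar (hσ : 0 < σ) (hη : 0 ≤ η) (j : Fin m) :
    gaussianLP A₀ b₀ c₀ (Real.toNNReal (σ ^ 2)) (smallDualVar η j) ≤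
      ENNReal.ofReal (η / (2 * σ)) := by
  refine gaussianLP_le_of_obj_gap hσ hη (measurableSet_smallDualVar η j)
    (fun A => (Matrix.of A).row j) (fun A => vecNorm_row_le_scale A j) ?_
  rintro A b c ⟨⟨x, y, h, hj⟩, -⟩ t ht ⟨-, hn⟩
  have ht0 : 0 ≤ t := (div_nonneg hη (scale_pos A).le).trans ht
  refine hn ⟨_, _, OptimalPair.add_row h j hj ht0, ?_⟩
  simp
  linarith

/-- After raising the coefficient of a positive variable by `t ≥ θ`, lowering it by `θ` leaves a net
increase `t - θ ≥ 0`, under which the variable stays positive. -/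
theorem gaussianLP_unstableVar (hσ : 0 < σ) (hη : 0 ≤ η) (i : Fin n) :
    gaussianLP A₀ b₀ c₀ (Real.toNNReal (σ ^ 2)) (unstableVar η i) ≤
      ENNReal.ofReal (η / (2 * σ)) := by
  refine gaussianLP_le_of_obj_gap hσ hη (measurableSet_unstableVar η i)
    (fun _ => Pi.single i 1) (fun A => vecNorm_single_le_scale i A) ?_
  rintro A b c ⟨⟨x, y, h, hi⟩, -⟩ t ht ⟨⟨x', y', h', -⟩, hn⟩
  have hs : 0 ≤ η / scale A := div_nonneg hη (scale_pos A).le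
  refine hn ?_
  obtain ⟨u, v, huv, hu⟩ := OptimalPair.exists_pos_of_le h i hi h' (sub_nonneg.2 ht)
    (sub_le_self t hs)
  refine ⟨u, v, ?_, hu⟩
  simpa only [Data.Opt, Data.lower, sub_smul, add_sub_assoc] using huv

theorem gaussianLP_unstableSlack (hσ : 0 < σ) (hη : 0 ≤ η) (j : Fin m) :
    gaussianLP A₀ b₀ c₀ (Real.toNNReal (σ ^ 2)) (unstableSlack η j) ≤
      ENNReal.ofReal (η / (2 * σ)) := by
  refine gaussianLP_le_of_obj_gap hσ hη (measurableSet_unstableSlack η j)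
    (fun A => -(Matrix.of A).row j) (fun A => ?_) ?_
  · rw [vecNorm_neg]; exact vecNorm_row_le_scale A j
  rintro A b c ⟨⟨x, y, h, hj⟩, -⟩ t ht ⟨⟨x', y', h', -⟩, hn⟩
  have hs : 0 ≤ η / scale A := div_nonneg hη (scale_pos A).le
  refine hn ?_
  have h'' : OptimalPair (Matrix.of A) b (c - t • (Matrix.of A).row j) x' y' := by
    simpa only [Data.Opt, smul_neg, ← sub_eq_add_neg] using h'
  obtain ⟨u, v, huv, hu⟩ := OptimalPair.exists_slack_pos_of_le h j hj h'' (sub_nonneg.2 ht)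
    (sub_le_self t hs)
  refine ⟨u, v, ?_, hu⟩
  have e : c + t • -(Matrix.of A).row j + (η / scale A) • (Matrix.of A).row j =
      c - (t - η / scale A) • (Matrix.of A).row j := by
    rw [sub_smul, smul_neg]; abel
  simpa only [Data.Opt, Data.raise, e] using huv

/-- `Data.lower` does not involve the right-hand side, so it commutes with moving `b` along column
`i`, which raises `x i` by `t`. -/
theorem gaussianLP_smallVar (hσ : 0 < σ) (hη : 0 ≤ η) (i : Fin n) :
    gaussianLP A₀ b₀ c₀ (Real.toNNReal (σ ^ 2)) (smallVar η i) ≤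
      ENNReal.ofReal (η / (2 * σ)) := by
  refine gaussianLP_le_of_rhs_gap hσ hη (measurableSet_smallVar η i)
    (fun A => (Matrix.of A).col i) (fun A => vecNorm_col_le_scale A i) ?_
  rintro A b c ⟨⟨x, y, h, hi⟩, -⟩ t ht ⟨-, hn⟩
  have ht0 : 0 ≤ t := (div_nonneg hη (scale_pos A).le).trans ht
  refine hn ⟨_, _, OptimalPair.add_col h i hi ht0, ?_⟩
  simp [Data.lower]
  linarith

theorem gaussianLP_smallSlack (hσ : 0 < σ) (hη : 0 ≤ η) (j : Fin m) :
    gaussianLP A₀ b₀ c₀ (Real.toNNReal (σ ^ 2)) (smallSlack η j) ≤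
      ENNReal.ofReal (η / (2 * σ)) := by
  refine gaussianLP_le_of_rhs_gap hσ hη (measurableSet_smallSlack η j)
    (fun _ => Pi.single j 1) (fun A => vecNorm_single_le_scale j A) ?_
  rintro A b c ⟨⟨x, y, h, hj⟩, -⟩ t ht ⟨-, hn⟩
  have ht0 : 0 ≤ t := (div_nonneg hη (scale_pos A).le).trans ht
  refine hn ⟨_, _, OptimalPair.relax h j hj ht0, ?_⟩
  simp [Data.raise, Data.primalSlack] at hj ⊢
  linarith

/-- The programs whose guess is fragile at scale `η`. -/
def fragile (m n : ℕ) (η : ℝ) : Set (Data m n) :=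
  (⋃ i, smallDualSlack η i ∪ unstableVar η i ∪ smallVar η i) ∪
    ⋃ j, smallDualVar η j ∪ unstableSlack η j ∪ smallSlack η j

theorem measure_iUnion_fin_le {Ω : Type*} [MeasurableSpace Ω] (μ : Measure Ω) {k : ℕ}
    (s t u : Fin k → Set Ω) {K : ℝ} (hK : 0 ≤ K) (hs : ∀ i, μ (s i) ≤ ENNReal.ofReal K)
    (ht : ∀ i, μ (t i) ≤ ENNReal.ofReal K) (hu : ∀ i, μ (u i) ≤ ENNReal.ofReal K) :
    μ (⋃ i, s i ∪ t i ∪ u i) ≤ ENNReal.ofReal (k * (3 * K)) := by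
  refine (measure_iUnion_fintype_le _ _).trans ?_
  refine (Finset.sum_le_sum (g := fun _ => ENNReal.ofReal (3 * K)) fun i _ => ?_).trans ?_
  · refine (measure_union_le _ _).trans ((add_le_add (measure_union_le _ _) le_rfl).trans ?_)
    refine (add_le_add (add_le_add (hs i) (ht i)) (hu i)).trans_eq ?_
    rw [← ENNReal.ofReal_add hK hK, ← ENNReal.ofReal_add (by positivity) hK]
    congr 1; ring
  · rw [Finset.sum_const, Finset.card_univ, Fintype.card_fin, nsmul_eq_mul,
      ENNReal.ofReal_mul (Nat.cast_nonneg k), ENNReal.ofReal_natCast]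

theorem gaussianLP_fragile (hσ : 0 < σ) (hη : 0 ≤ η) :
    gaussianLP A₀ b₀ c₀ (Real.toNNReal (σ ^ 2)) (fragile m n η) ≤
      ENNReal.ofReal ((n + m) * (3 * (η / (2 * σ)))) := by
  have hK : 0 ≤ η / (2 * σ) := by positivity
  rw [add_mul, ENNReal.ofReal_add (by positivity) (by positivity)]
  refine (measure_union_le _ _).trans (add_le_add ?_ ?_)
  · exact measure_iUnion_fin_le _ _ _ _ hK (gaussianLP_smallDualSlack A₀ b₀ c₀ hσ hη)
      (gaussianLP_unstableVar A₀ b₀ c₀ hσ hη) (gaussianLP_smallVar A₀ b₀ c₀ hσ hη)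
  · exact measure_iUnion_fin_le _ _ _ _ hK (gaussianLP_smallDualVar A₀ b₀ c₀ hσ hη)
      (gaussianLP_unstableSlack A₀ b₀ c₀ hσ hη) (gaussianLP_smallSlack A₀ b₀ c₀ hσ hη)

/-- The right-hand side is a combination of too few columns of the matrix and unit vectors. -/
def sparseRhs (U : Finset (Fin n)) (W : Finset (Fin m)) : Set (Data m n) :=
  {P | ∃ x s, (∀ i, i ∉ U → x i = 0) ∧ (∀ j, j ∉ W → s j = 0) ∧
    P.2.1 = Matrix.of P.1 *ᵥ x + s}

/-- The objective is a combination of too few rows of the matrix and unit vectors. -/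
def sparseObj (V : Finset (Fin m)) (Z : Finset (Fin n)) : Set (Data m n) :=
  {P | ∃ y z, (∀ j, j ∉ V → y j = 0) ∧ (∀ i, i ∉ Z → z i = 0) ∧
    P.2.2 = (Matrix.of P.1)ᵀ *ᵥ y + z}

/-- The programs whose right-hand side or objective is sparse in terms of rows or columns. -/
def degenerate (m n : ℕ) : Set (Data m n) :=
  (⋃ p : {p : Finset (Fin n) × Finset (Fin m) // p.1.card + p.2.card < m},
      sparseRhs p.1.1 p.1.2) ∪
    ⋃ p : {p : Finset (Fin m) × Finset (Fin n) // p.1.card + p.2.card < n}, sparseObj p.1.1 p.1.2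

theorem measurableSet_sparseRhs (U : Finset (Fin n)) (W : Finset (Fin m)) :
    MeasurableSet (sparseRhs U W) := by
  have hC : IsClosed {q : Data m n × (Fin n → ℝ) × (Fin m → ℝ) | (∀ i, i ∉ U → q.2.1 i = 0) ∧
      (∀ j, j ∉ W → q.2.2 j = 0) ∧ q.1.2.1 = Matrix.of q.1.1 *ᵥ q.2.1 + q.2.2} := by
    simp only [Set.ofPred_and, Set.ofPred_forall]
    refine .inter ?_ (.inter ?_ ?_)
    · exact isClosed_iInter fun i => isClosed_iInter fun _ => isClosed_eq (by fun_prop) (by fun_prop)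
    · exact isClosed_iInter fun i => isClosed_iInter fun _ => isClosed_eq (by fun_prop) (by fun_prop)
    · refine isClosed_eq (by fun_prop) (continuous_pi fun j => ?_)
      simp only [Pi.add_apply, Matrix.mulVec, dotProduct, Matrix.of_apply]
      fun_prop
  simpa [sparseRhs] using measurableSet_exists_mem hC

theorem measurableSet_sparseObj (V : Finset (Fin m)) (Z : Finset (Fin n)) :
    MeasurableSet (sparseObj V Z) := by
  have hC : IsClosed {q : Data m n × (Fin m → ℝ) × (Fin n → ℝ) | (∀ j, j ∉ V → q.2.1 j = 0) ∧
      (∀ i, i ∉ Z → q.2.2 i = 0) ∧ q.1.2.2 = (Matrix.of q.1.1)ᵀ *ᵥ q.2.1 + q.2.2} := by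
    simp only [Set.ofPred_and, Set.ofPred_forall]
    refine .inter ?_ (.inter ?_ ?_)
    · exact isClosed_iInter fun i => isClosed_iInter fun _ => isClosed_eq (by fun_prop) (by fun_prop)
    · exact isClosed_iInter fun i => isClosed_iInter fun _ => isClosed_eq (by fun_prop) (by fun_prop)
    · refine isClosed_eq (by fun_prop) (continuous_pi fun j => ?_)
      simp only [Pi.add_apply, Matrix.mulVec, dotProduct, Matrix.of_apply, Matrix.transpose_apply]
      fun_prop
  simpa [sparseObj] using measurableSet_exists_mem hC

theorem gaussianLP_degenerate (hσ : 0 < σ) :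
    gaussianLP A₀ b₀ c₀ (Real.toNNReal (σ ^ 2)) (degenerate m n) = 0 := by
  refine measure_union_null (measure_iUnion_null fun p => ?_) (measure_iUnion_null fun p => ?_)
  · exact le_antisymm (gaussianLP_le_of_forall_rhs (measurableSet_sparseRhs _ _) fun A c =>
      (gaussianVec_sparse b₀ hσ (Matrix.of A) p.1.1 p.1.2 p.2).le) bot_le
  · exact le_antisymm (gaussianLP_le_of_forall_obj (measurableSet_sparseObj _ _) fun A b =>
      (gaussianVec_sparse c₀ hσ (Matrix.of A)ᵀ p.1.1 p.1.2 p.2).le) bot_le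

end probability

/-! ### Robust programs have large `δ`. -/

section termination

/-- Nondegenerate programs are strictly complementary, with square optimal type. -/
theorem strictlyComplementary {P : Data m n} (hP : P ∉ degenerate m n) {x : Fin n → ℝ}
    {y : Fin m → ℝ} (h : P.Opt x y) :
    (Finset.univ.filter fun i => 0 < x i).card = (Finset.univ.filter fun j => 0 < y j).card ∧
      ∀ j, ¬ 0 < y j → 0 < P.primalSlack x j := by
  classical
  obtain ⟨h1, h2⟩ := OptimalPair.complementary h
  set U := Finset.univ.filter fun i => 0 < x i
  set V := Finset.univ.filter fun j => 0 < y j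
  set W := Finset.univ.filter fun j => 0 < P.primalSlack x j
  set Z := Finset.univ.filter fun i => 0 < P.dualSlack y i
  have hx : ∀ i, i ∉ U → x i = 0 := fun i hi =>
    le_antisymm (not_lt.1 fun h' => hi (by simp [U, h'])) (h.1.2 i)
  have hy : ∀ j, j ∉ V → y j = 0 := fun j hj =>
    le_antisymm (not_lt.1 fun h' => hj (by simp [V, h'])) (h.2.1.2 j)
  have hs : ∀ j, j ∉ W → P.primalSlack x j = 0 := fun j hj =>
    le_antisymm (not_lt.1 fun h' => hj (by simp [W, h'])) (h.1.slack_nonneg j)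
  have hz : ∀ i, i ∉ Z → P.dualSlack y i = 0 := fun i hi =>
    le_antisymm (not_lt.1 fun h' => hi (by simp [Z, h'])) (h.2.1.slack_nonneg i)
  -- The right-hand side is `A x` plus the slack vector, so it is spanned by the columns in `U` and
  -- the unit vectors in `W`; the objective is treated dually. With the disjointness from
  -- complementarity, all four cardinality inequalities become equalities.
  have c1 : m ≤ U.card + W.card := by
    by_contra! hlt
    refine hP (Or.inl (Set.mem_iUnion.2 ⟨⟨(U, W), hlt⟩, x, P.primalSlack x, hx, hs, ?_⟩))
    ext j; simp [Data.primalSlack]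
  have c2 : n ≤ V.card + Z.card := by
    by_contra! hlt
    refine hP (Or.inr (Set.mem_iUnion.2 ⟨⟨(V, Z), hlt⟩, y, -P.dualSlack y, hy, fun i hi => ?_, ?_⟩))
    · simp [hz i hi]
    · ext i; simp [Data.dualSlack, Matrix.mulVec_transpose]
  have d1 : Disjoint V W := Finset.disjoint_left.2 fun j hj hj' => by
    simp only [V, W, Finset.mem_filter, Finset.mem_univ, true_and] at hj hj'
    exact (mul_pos hj hj').ne' (h2 j)
  have d2 : Disjoint U Z := Finset.disjoint_left.2 fun i hi hi' => by
    simp only [U, Z, Finset.mem_filter, Finset.mem_univ, true_and] at hi hi'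
    exact (mul_pos hi' hi).ne' (h1 i)
  have e1 : V.card + W.card ≤ m := by
    simpa [Finset.card_union_of_disjoint d1] using Finset.card_le_univ (V ∪ W)
  have e2 : U.card + Z.card ≤ n := by
    simpa [Finset.card_union_of_disjoint d2] using Finset.card_le_univ (U ∪ Z)
  refine ⟨by omega, fun j hj => ?_⟩
  have hfull : V ∪ W = Finset.univ := Finset.eq_univ_of_card _ (by
    rw [Finset.card_union_of_disjoint d1, Fintype.card_fin]; omega)
  have := hfull ▸ Finset.mem_univ j
  simpa [V, W, hj] using this

/-- If exactly the indices in `Uᶜ` and `V` have slack below a threshold, then `(U, V)` is the only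
guess. -/
theorem IsGuess.eq_of_threshold {A : Matrix (Fin m) (Fin n) ℝ} {b : Fin m → ℝ} {x : Fin n → ℝ}
    {U U' : Finset (Fin n)} {V V' : Finset (Fin m)} (h : IsGuess A b x U' V')
    (hcard : U.card = V.card) (r : ℝ) (hlow : ∀ s ∈ Uᶜ.disjSum V, slack A b x s < r)
    (hhigh : ∀ s ∉ Uᶜ.disjSum V, r ≤ slack A b x s) : U' = U ∧ V' = V := by
  have hT : (Uᶜ.disjSum V).card = n := by
    have := Finset.card_le_univ U
    rw [Fintype.card_fin] at this
    rw [Finset.card_disjSum, Finset.card_compl, Fintype.card_fin]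
    omega
  -- Exchange argument: with equal sizes, a guess containing a slack above the threshold misses one
  -- below it.
  have hsub : U'ᶜ.disjSum V' ⊆ Uᶜ.disjSum V := by
    intro s hs
    by_contra hn
    obtain ⟨t, ht, ht'⟩ : ∃ t ∈ Uᶜ.disjSum V, t ∉ U'ᶜ.disjSum V' := by
      by_contra! hall
      have heq := Finset.eq_of_subset_of_card_le hall (by rw [h.1, hT])
      exact hn (heq ▸ hs)
    linarith [h.2 s hs t ht', hlow t ht, hhigh s hn]
  have heq := Finset.eq_of_subset_of_card_le hsub (by rw [h.1, hT])
  constructor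
  · ext i
    have := Finset.ext_iff.1 heq (Sum.inl i)
    simp only [Finset.inl_mem_disjSum, Finset.mem_compl] at this
    exact not_iff_not.1 this
  · ext j
    simpa using Finset.ext_iff.1 heq (Sum.inr j)

/-- Near-optimal points of a robust nondegenerate program have the slacks of `Uᶜ` and `V` below
and the other slacks above a threshold. -/
theorem slack_threshold {P : Data m n} {η : ℝ} (hη : 0 < η) (hP : P ∉ degenerate m n)
    (hP' : P ∉ fragile m n η) {x : Fin n → ℝ} {y : Fin m → ℝ} (h : P.Opt x y)
    {w : Fin n → ℝ} (hw : PrimalFeasible (Matrix.of P.1) P.2.1 w)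
    (hgap : P.2.2 ⬝ᵥ x - P.2.2 ⬝ᵥ w < (η / scale P.1) ^ 2 / 2) :
    (∀ i, if 0 < x i then η / scale P.1 / 2 < w i else w i < η / scale P.1 / 2) ∧
    ∀ j, if 0 < y j then P.primalSlack w j < η / scale P.1 / 2
      else η / scale P.1 / 2 < P.primalSlack w j := by
  set θ := η / scale P.1 with hθ
  have hθ0 : 0 < θ := div_pos hη (scale_pos _)
  simp only [fragile, Set.mem_union, Set.mem_iUnion, not_or, not_exists] at hP'
  obtain ⟨hX, hY⟩ := hP'
  have hopt : ∀ {u v}, P.Opt u v → P.2.2 ⬝ᵥ u = P.2.2 ⬝ᵥ x := fun huv =>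
    le_antisymm (h.isPrimalOptimal.2 _ huv.1) (huv.isPrimalOptimal.2 _ h.1)
  -- Every dual optimum has the same value, so the complementarity sum of `w` with any of them is
  -- the objective gap.
  have hsum : ∀ {u v}, P.Opt u v →
      P.dualSlack v ⬝ᵥ w + v ⬝ᵥ P.primalSlack w < θ ^ 2 / 2 := fun {u v} huv => by
    have e := dotProduct_sub_dotProduct (Matrix.of P.1) P.2.1 P.2.2 w v
    rw [← huv.2.2, hopt huv] at e
    exact e.symm.trans_lt hgap
  constructor
  · intro i
    obtain ⟨⟨hz, hu⟩, hs⟩ := hX i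
    split_ifs with hi
    · have h1 : P.lower η i ∈ posVar i := by
        by_contra hn
        exact hu ⟨⟨x, y, h, hi⟩, hn⟩
      obtain ⟨u, v, huv, hle⟩ : ∃ u v, (P.lower η i).Opt u v ∧ θ ≤ u i := by
        by_contra hn
        exact hs ⟨h1, hn⟩
      -- Optimality of `u` for the lowered objective and of `x` for the original one give `θ (u i -
      -- w i) ≤ c x - c w < θ² / 2`.
      have h2 := huv.isPrimalOptimal.2 w hw
      have h3 := h.isPrimalOptimal.2 u huv.1
      simp only [Data.lower, sub_dotProduct, smul_dotProduct, single_dotProduct, smul_eq_mul,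
        one_mul, ← hθ] at h2
      nlinarith
    · obtain ⟨u, v, huv, hle⟩ : ∃ u v, P.Opt u v ∧ θ ≤ P.dualSlack v i := by
        by_contra hn
        exact hz ⟨⟨x, y, h, not_lt.1 hi⟩, hn⟩
      have h1 := hsum huv
      have h2 : 0 ≤ v ⬝ᵥ P.primalSlack w :=
        dotProduct_nonneg_of_nonneg huv.2.1.2 hw.slack_nonneg
      have h3 : P.dualSlack v i * w i ≤ P.dualSlack v ⬝ᵥ w :=
        Finset.single_le_sum (f := fun i => P.dualSlack v i * w i)
          (fun l _ => mul_nonneg (huv.2.1.slack_nonneg l) (hw.2 l)) (Finset.mem_univ i)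
      have h4 : 0 ≤ w i := hw.2 i
      nlinarith
  · intro j
    obtain ⟨⟨hz, hu⟩, hs⟩ := hY j
    split_ifs with hj
    · obtain ⟨u, v, huv, hle⟩ : ∃ u v, P.Opt u v ∧ θ ≤ v j := by
        by_contra hn
        exact hz ⟨⟨x, y, h, hj⟩, hn⟩
      have h1 := hsum huv
      have h2 : 0 ≤ P.dualSlack v ⬝ᵥ w :=
        dotProduct_nonneg_of_nonneg huv.2.1.slack_nonneg hw.2
      have h3 : v j * P.primalSlack w j ≤ v ⬝ᵥ P.primalSlack w :=
        Finset.single_le_sum (f := fun j => v j * P.primalSlack w j)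
          (fun l _ => mul_nonneg (huv.2.1.2 l) (hw.slack_nonneg l)) (Finset.mem_univ j)
      have h4 : 0 ≤ P.primalSlack w j := hw.slack_nonneg j
      nlinarith
    · have h1 : P.raise η j ∈ posSlack j := by
        by_contra hn
        exact hu ⟨⟨x, y, h, (strictlyComplementary hP h).2 j hj⟩, hn⟩
      obtain ⟨u, v, huv, hle⟩ : ∃ u v, (P.raise η j).Opt u v ∧ θ ≤ P.primalSlack u j := by
        by_contra hn
        exact hs ⟨h1, hn⟩
      have h2 := huv.isPrimalOptimal.2 w hw
      have h3 := h.isPrimalOptimal.2 u huv.1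
      simp only [Data.raise, add_dotProduct, smul_dotProduct, smul_eq_mul, ← hθ] at h2
      have e : ∀ q, P.primalSlack q j = P.2.1 j - (Matrix.of P.1).row j ⬝ᵥ q := fun q => rfl
      rw [e] at hle ⊢
      nlinarith

theorem isGuess_unique {P : Data m n} {η : ℝ} (hη : 0 < η) (hP : P ∉ degenerate m n)
    (hP' : P ∉ fragile m n η) (hF : FeasibleBounded (Matrix.of P.1) P.2.1 P.2.2)
    {w : Fin n → ℝ} (hw : PrimalFeasible (Matrix.of P.1) P.2.1 w)
    (hgap : P.2.2 ⬝ᵥ xStar (Matrix.of P.1) P.2.1 P.2.2 - P.2.2 ⬝ᵥ w < (η / scale P.1) ^ 2 / 2)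
    {U : Finset (Fin n)} {V : Finset (Fin m)} (hG : IsGuess (Matrix.of P.1) P.2.1 w U V) :
    U = typeU (Matrix.of P.1) P.2.1 P.2.2 ∧ V = typeV (Matrix.of P.1) P.2.1 P.2.2 := by
  have h : P.Opt _ _ := hF.optimalPair_star
  obtain ⟨h1, h2⟩ := slack_threshold hη hP hP' h hw hgap
  have hcard : (typeU (Matrix.of P.1) P.2.1 P.2.2).card =
      (typeV (Matrix.of P.1) P.2.1 P.2.2).card := by
    unfold typeU typeV
    convert (strictlyComplementary hP h).1
  refine hG.eq_of_threshold hcard (η / scale P.1 / 2) ?_ ?_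
  · rintro (i | j) hs
    · have := h1 i
      rw [if_neg (by simpa [typeU] using hs)] at this
      exact this
    · have := h2 j
      rw [if_pos (by simpa [typeV] using hs)] at this
      exact this
  · rintro (i | j) hs
    · have := h1 i
      rw [if_pos (by simpa [typeU] using hs)] at this
      exact this.le
    · have := h2 j
      rw [if_neg (by simpa [typeV] using hs)] at this
      exact this.le

/-- A robust nondegenerate program has large `δ`. -/
theorem ofReal_le_delta {P : Data m n} {η : ℝ} (hη : 0 < η) (hP : P ∉ degenerate m n)
    (hP' : P ∉ fragile m n η) :
    ENNReal.ofReal ((η / scale P.1) ^ 2 / 2) ≤ delta (Matrix.of P.1) P.2.1 P.2.2 := by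
  unfold delta
  split_ifs with hF
  · refine le_iSup₂_of_le (Real.toNNReal ((η / scale P.1) ^ 2 / 2))
      (fun w hw hgap U V hG => ?_) le_rfl
    rw [Real.coe_toNNReal _ (by positivity)] at hgap
    exact isGuess_unique hη hP hP' hF hw hgap hG
  · exact le_top

/-- For `n = 0` the final bound is zero, so this case must be excluded almost surely: a guess has no
members, and `V` is empty because |V| = |U| = 0. -/
theorem delta_eq_top_of_no_variables {P : Data m 0} (hP : P ∉ degenerate m 0) :
    delta (Matrix.of P.1) P.2.1 P.2.2 = ⊤ := by
  unfold delta
  split_ifs with hF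
  · have hV : typeV (Matrix.of P.1) P.2.1 P.2.2 = ∅ := by
      have h : P.Opt _ _ := hF.optimalPair_star
      have := (strictlyComplementary hP h).1
      rw [Finset.univ_eq_empty, Finset.filter_empty, Finset.card_empty] at this
      unfold typeV
      convert Finset.card_eq_zero.1 this.symm
    refine ENNReal.eq_top_of_forall_nnreal_le fun d => le_iSup₂_of_le d
      (fun w _ _ U V hG => ⟨Subsingleton.elim _ _, ?_⟩) le_rfl
    have := hG.1
    rw [Finset.card_disjSum] at this
    rw [hV, ← Finset.card_eq_zero]
    omega
  · rfl

/-- The event that `δ`, normalized by the norms of the data and the solutions, is at most `ε`. -/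
def smallDelta (m n : ℕ) (ε : ℝ) : Set (Data m n) :=
  {P | delta (Matrix.of P.1) P.2.1 P.2.2 *
      ENNReal.ofReal ((opNorm (Matrix.of P.1) + 3) ^ 7 *
        (1 + vecNorm (xStar (Matrix.of P.1) P.2.1 P.2.2)
          + vecNorm (yStar (Matrix.of P.1) P.2.1 P.2.2)) ^ 4) ≤ ENNReal.ofReal ε}

theorem scale_pow_le_normalization (P : Data m n) :
    scale P.1 ^ 7 ≤ (opNorm (Matrix.of P.1) + 3) ^ 7 *
        (1 + vecNorm (xStar (Matrix.of P.1) P.2.1 P.2.2)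
          + vecNorm (yStar (Matrix.of P.1) P.2.1 P.2.2)) ^ 4 := by
  have h1 := vecNorm_nonneg (xStar (Matrix.of P.1) P.2.1 P.2.2)
  have h2 := vecNorm_nonneg (yStar (Matrix.of P.1) P.2.1 P.2.2)
  exact le_mul_of_one_le_right (pow_nonneg (scale_pos P.1).le 7) (one_le_pow₀ (by linarith))

/-- Only an inclusion is needed: the right-hand side is controlled, and measurability of the event
involving the chosen optima plays no role. The spare factor `scale ^ 5 / 2 ≥ 3 ^ 5 / 2 > 1` makes
the comparison with `ε` strict. -/
theorem smallDelta_subset {ε η : ℝ} (hη : 0 < η) (hεη : ε ≤ η ^ 2) :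
    smallDelta m n ε ⊆ degenerate m n ∪ fragile m n η := by
  intro P hP
  by_contra hn
  rw [Set.mem_union, not_or] at hn
  have h1 := ofReal_le_delta hη hn.1 hn.2
  have h2 := (mul_le_mul' h1
    (ENNReal.ofReal_le_ofReal (scale_pow_le_normalization P))).trans hP
  have hs := three_le_scale P.1
  have hs0 := scale_pos P.1
  rw [← ENNReal.ofReal_mul (by positivity)] at h2
  have h3 : (η / scale P.1) ^ 2 / 2 * scale P.1 ^ 7 = η ^ 2 * (scale P.1 ^ 5 / 2) := by
    field_simp
  have h4 : (3 : ℝ) ^ 5 ≤ scale P.1 ^ 5 := by gcongr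
  have h5 : 0 < η ^ 2 := by positivity
  rw [h3] at h2
  have h6 : ε < η ^ 2 * (scale P.1 ^ 5 / 2) := by nlinarith
  exact absurd h2 (not_le.2 ((ENNReal.ofReal_lt_ofReal_iff (by positivity)).2 h6))

theorem smallDelta_subset_of_no_variables (ε : ℝ) : smallDelta m 0 ε ⊆ degenerate m 0 := by
  intro P hP
  by_contra hn
  have h1 := delta_eq_top_of_no_variables hn
  have h2 : 0 < scale P.1 ^ 7 := pow_pos (scale_pos P.1) 7
  rw [smallDelta, Set.mem_ofPred_eq, h1, ENNReal.top_mul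
    (ENNReal.ofReal_pos.2 (h2.trans_le (scale_pow_le_normalization P))).ne'] at hP
  exact absurd hP (by simp)

variable (A₀ : Matrix (Fin m) (Fin n) ℝ) (b₀ : Fin m → ℝ) (c₀ : Fin n → ℝ) {σ : ℝ}

/-- Smoothed bound for the normalized `δ` with a square root dependence on `ε`. -/
theorem gaussianLP_smallDelta (hσ : 0 < σ) (ε : ℝ) :
    gaussianLP A₀ b₀ c₀ (Real.toNNReal (σ ^ 2)) (smallDelta m n ε) ≤
      ENNReal.ofReal ((n + m) * (3 * (√ε / (2 * σ)))) := by
  -- Robustness needs `η > 0`, so `√ε` is approached from above, which covers `ε = 0`.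
  have hbound : ∀ η : ℝ, √ε < η → gaussianLP A₀ b₀ c₀ (Real.toNNReal (σ ^ 2)) (smallDelta m n ε) ≤
      ENNReal.ofReal ((n + m) * (3 * (η / (2 * σ)))) := fun η hη => by
    have hη0 : 0 < η := (Real.sqrt_nonneg ε).trans_lt hη
    refine (measure_mono (smallDelta_subset hη0
      ((Real.sqrt_le_left hη0.le).1 hη.le))).trans ((measure_union_le _ _).trans ?_)
    rw [gaussianLP_degenerate A₀ b₀ c₀ hσ, zero_add]
    exact gaussianLP_fragile A₀ b₀ c₀ hσ hη0.le
  have hlim : Filter.Tendsto (fun η : ℝ => ENNReal.ofReal ((n + m) * (3 * (η / (2 * σ)))))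
      (nhdsWithin √ε (Set.Ioi √ε)) (nhds (ENNReal.ofReal ((n + m) * (3 * (√ε / (2 * σ)))))) :=
    ((ENNReal.continuous_ofReal.comp (by fun_prop)).tendsto √ε).mono_left nhdsWithin_le_nhds
  exact ge_of_tendsto hlim (Filter.eventually_of_mem self_mem_nhdsWithin hbound)

end termination

end LinProg

/-! ### The stated bound. -/

theorem lemma6p4 {m n : ℕ} (hmn : n ≤ m)
    (A₀ : Matrix (Fin m) (Fin n) ℝ) (b₀ : Fin m → ℝ) (c₀ : Fin n → ℝ)
    (hA : LinProg.opNorm A₀ ≤ 1) (hb : LinProg.vecNorm b₀ ≤ 1) (hc : LinProg.vecNorm c₀ ≤ 1)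
    (σ : ℝ) (hσ : 0 < σ) (hσ1 : σ ^ 2 ≤ 1) (ε : ℝ) (hε : 0 ≤ ε) :
    LinProg.gaussianLP A₀ b₀ c₀ (Real.toNNReal (σ ^ 2))
      {P | LinProg.delta (Matrix.of P.1) P.2.1 P.2.2 *
          ENNReal.ofReal ((LinProg.opNorm (Matrix.of P.1) + 3) ^ 7 *
            (1 + LinProg.vecNorm (LinProg.xStar (Matrix.of P.1) P.2.1 P.2.2)
              + LinProg.vecNorm (LinProg.yStar (Matrix.of P.1) P.2.1 P.2.2)) ^ 4)
        ≤ ENNReal.ofReal ε}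
      ≤ ENNReal.ofReal
          (21 * ε ^ (1 / 3 : ℝ) * (n : ℝ) ^ (1 / 6 : ℝ) * ((n : ℝ) + 1) * ((m : ℝ) + 1) / σ ^ 2) := by
  change LinProg.gaussianLP A₀ b₀ c₀ _ (LinProg.smallDelta m n ε) ≤ _
  rcases Nat.eq_zero_or_pos n with rfl | hn
  · rw [le_antisymm ((measure_mono (LinProg.smallDelta_subset_of_no_variables ε)).trans_eq
      (LinProg.gaussianLP_degenerate A₀ b₀ c₀ hσ)) bot_le]
    exact bot_le
  have hn1 : (1 : ℝ) ≤ n := by exact_mod_cast hn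
  have hm0 : (0 : ℝ) ≤ m := Nat.cast_nonneg m
  have hroot : (1 : ℝ) ≤ (n : ℝ) ^ (1 / 6 : ℝ) := Real.one_le_rpow hn1 (by norm_num)
  have hσ2 : 0 < σ ^ 2 := by positivity
  have hσle : σ ≤ 1 := by nlinarith
  rcases le_or_gt 1 ε with h1 | h1
  -- For `ε ≥ 1` and `n ≥ 1` the right-hand side is at least 1.
  · refine prob_le_one.trans ?_
    rw [← ENNReal.ofReal_one]
    apply ENNReal.ofReal_le_ofReal
    have h2 : (1 : ℝ) ≤ ε ^ (1 / 3 : ℝ) := Real.one_le_rpow h1 (by norm_num)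
    rw [le_div_iff₀ hσ2, one_mul]
    calc σ ^ 2 ≤ 21 * 1 * 1 * 1 * 1 := by linarith
      _ ≤ _ := by gcongr <;> linarith
  · refine (LinProg.gaussianLP_smallDelta A₀ b₀ c₀ hσ ε).trans (ENNReal.ofReal_le_ofReal ?_)
    have h2 : √ε ≤ ε ^ (1 / 3 : ℝ) := by
      rw [Real.sqrt_eq_rpow]
      exact Real.rpow_le_rpow_of_exponent_ge_of_imp hε h1.le (by norm_num) (by norm_num)
    have h3 : 0 ≤ ε ^ (1 / 3 : ℝ) := Real.rpow_nonneg hε _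
    -- Here `√ε ≤ ε ^ (1/3)` as `ε < 1`, and `σ² ≤ 2σ` as `σ ≤ 1`; the constant 3 lies well below
    -- 21.
    calc ((n : ℝ) + m) * (3 * (√ε / (2 * σ)))
        ≤ (((n : ℝ) + 1) * (m + 1)) * (3 * (ε ^ (1 / 3 : ℝ) / σ ^ 2)) := by
          gcongr
          · nlinarith
          · nlinarith
      _ = 3 * ε ^ (1 / 3 : ℝ) * 1 * (n + 1) * (m + 1) / σ ^ 2 := by ring
      _ ≤ _ := by gcongr; norm_num
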